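/- Let $\mathcal O$ be a complete discrete valuation ring with field of fractions of characteristic $0$ and finite residue field $k$ of characteristic $p$ with $q=p^h$ elements, and let $\pi$ be a uniformizing parameter of $\mathcal O$. Write $W$ for $p$-typical Witt vectors and view $\mathcal O$ as a $W(k)$-algebra via the unique ring homomorphism $W(k)\to\mathcal O$ inducing the identity on $k$. The Greenberg algebra $\mathbb R_{\mathcal O}$ is the affine $k$-scheme of $\mathcal O$-algebras with $\mathbb R_{\mathcal O}(A)=W(A)\otimes_{W(k)}\mathcal O$ for every $k$-algebra $A$. For an $\mathcal O$-algebra $B$, the $\mathcal O$-algebra of ramified Witt vectors $W_{\mathcal O}(B)$ is the set $B^{\mathbb N_0}$ with the $\mathcal O$-algebra structure, natural in $B$, for which $(b_n)_n\mapsto\bigl(\sum_{i=0}^{n}\pi^i b_i^{q^{n-i}}\bigr)_n$ is a homomorphism of $\mathcal O$-algebras to the product algebra $B^{\mathbb N_0}$; it is represented by an affine $\mathcal O$-scheme $\mathbb W_{\mathcal O}$ of $\mathcal O$-algebras, with special fiber $\mathbb W_{\mathcal O,k}=\mathbb W_{\mathcal O}\times_{\mathcal O}\operatorname{Spec}k$.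 Let $u\colon W(B)\to W_{\mathcal O}(B)$ be the Drinfeld map, i.e. the ring homomorphism, natural in the $\mathcal O$-algebra $B$, such that $\sum_{i=0}^{n}\pi^i u(\boldsymbol b)_i^{q^{n-i}}=\sum_{i=0}^{hn}p^i b_i^{p^{hn-i}}$ for all $n\ge 0$ and $\boldsymbol b\in W(B)$. For $k$-algebras $A$, the homomorphisms of $\mathcal O$-algebras $r_A=u\otimes\mathrm{id}_{\mathcal O}\colon W(A)\otimes_{W(k)}\mathcal O\to W_{\mathcal O}(A)$ define a morphism of ring schemes over $k$ $$\boldsymbol r\colon \mathbb R_{\mathcal O}\to\mathbb W_{\mathcal O,k}.$$ For a $k$-scheme $X$ let $X^{\mathrm{pf}}$ be its inverse perfection, the inverse limit of copies of $X$ with the absolute ($p$-power) Frobenius as transition maps. Then: 1. $\boldsymbol r$ induces an isomorphism $\boldsymbol r^{\mathrm{pf}}\colon\mathbb R_{\mathcal O}^{\mathrm{pf}}\to\mathbb W_{\mathcal O,k}^{\mathrm{pf}}$; 2. $\boldsymbol r$ is a universal homeomorphism, in particular it is surjective; 3. the kernel of $\boldsymbol r$, i.e. the commutative $k$-group scheme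 $A\mapsto\ker(r_A)$, is pro-infinitesimal: it is a cofiltered inverse limit of infinitesimal commutative $k$-group schemes, that is, of $k$-group schemes whose underlying scheme is the spectrum of a finite-dimensional local $k$-algebra. -/

import Mathlib

open CategoryTheory Limits AlgebraicGeometry IsLocalRing TensorProduct

universe u v

set_option linter.unusedSectionVars false

noncomputable section

/-- A uniformizing parameter of a discrete valuation ring. -/
abbrev Uniformizer (O : Type u) [CommRing O] : Type u := {ϖ : O // Irreducible ϖ}

namespace RamifiedWitt

/-! ### Congruences and the image of the ghost map -/

section Congruence

variable {B : Type v} [CommRing B]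

/-- The `n`-th ghost component `b₀ ^ q ^ n + w * b₁ ^ q ^ (n - 1) + ... + w ^ n * bₙ`. -/
def ghost (w : B) (q : ℕ) (b : ℕ → B) (n : ℕ) : B :=
  ∑ i ∈ Finset.range (n + 1), w ^ i * b i ^ q ^ (n - i)

theorem map_ghost {C : Type*} [CommRing C] (f : B →+* C) (w : B) (q : ℕ) (b : ℕ → B) (n : ℕ) :
    f (ghost w q b n) = ghost (f w) q (fun i => f (b i)) n := by
  simp [ghost, map_sum]

theorem pow_dvd_pow_sub_pow {w x y : B} {m : ℕ} (hm : w ∣ (m : B)) (h : w ∣ x - y) (j : ℕ) :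
    w ^ (j + 1) ∣ x ^ m ^ j - y ^ m ^ j := by
  induction j with
  | zero => simpa using h
  | succ j ih =>
    rw [pow_succ m, pow_mul, pow_mul, ← (Commute.all _ _).mul_geom_sum₂, pow_succ]
    refine mul_dvd_mul ih ?_
    rw [dvd_geom_sum₂_iff_of_dvd_sub ((dvd_pow_self w (Nat.succ_ne_zero j)).trans ih)]
    exact hm.mul_right _

theorem pow_dvd_ghost_sub {w : B} {q : ℕ} {σ : B →+* B} (hw : σ w = w) (hq : w ∣ (q : B))
    (hσ : ∀ b, w ∣ σ b - b ^ q) (b : ℕ → B) (n : ℕ) :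
    w ^ (n + 1) ∣ (∑ i ∈ Finset.range (n + 1), w ^ i * b i ^ q ^ (n + 1 - i)) -
      σ (ghost w q b n) := by
  rw [map_ghost, ghost, ← Finset.sum_sub_distrib]
  refine Finset.dvd_sum fun i hi => ?_
  have hi : i ≤ n := Nat.lt_succ_iff.mp (Finset.mem_range.mp hi)
  have h1 : n + 1 - i = (n - i) + 1 := by omega
  rw [hw, ← mul_sub, h1, pow_succ' q, pow_mul, show n + 1 = i + ((n - i) + 1) by omega, pow_add]
  refine mul_dvd_mul_left _ ?_
  rw [← dvd_neg, neg_sub]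
  exact pow_dvd_pow_sub_pow hq (hσ _) _

theorem pow_dvd_ghost_succ_sub {w : B} {q : ℕ} {σ : B →+* B} (hw : σ w = w) (hq : w ∣ (q : B))
    (hσ : ∀ b, w ∣ σ b - b ^ q) (b : ℕ → B) (n : ℕ) :
    w ^ (n + 1) ∣ ghost w q b (n + 1) - σ (ghost w q b n) := by
  rw [show ghost w q b (n + 1) = (∑ i ∈ Finset.range (n + 1), w ^ i * b i ^ q ^ (n + 1 - i)) +
    w ^ (n + 1) * b (n + 1) by simp [ghost, Finset.sum_range_succ _ (n + 1)], add_sub_right_comm]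
  exact dvd_add (pow_dvd_ghost_sub hw hq hσ b n) (dvd_mul_right _ _)

theorem exists_ghost_eq {w : B} {q : ℕ} {σ : B →+* B} (hw : σ w = w) (hq : w ∣ (q : B))
    (hσ : ∀ b, w ∣ σ b - b ^ q) (a : ℕ → B) (ha : ∀ n, w ^ (n + 1) ∣ a (n + 1) - σ (a n)) :
    ∃ b : ℕ → B, ∀ n, ghost w q b n = a n := by
  have key : ∀ n, ∀ b : ℕ → B, (∀ m < n, ghost w q b m = a m) →
      ∃ c, ∀ m ≤ n, ghost w q (Function.update b n c) m = a m := by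
    intro n b hb
    obtain ⟨c, hc⟩ : w ^ n ∣ a n - ∑ i ∈ Finset.range n, w ^ i * b i ^ q ^ (n - i) := by
      cases n with
      | zero => simp
      | succ n =>
        have h1 := ha n
        rw [← hb n (Nat.lt_succ_self n)] at h1
        have h2 := pow_dvd_ghost_sub hw hq hσ b n
        have := dvd_sub h1 h2
        rwa [sub_sub_sub_cancel_right] at this
    refine ⟨c, fun m hm => ?_⟩
    have hlt : ∀ i < n, Function.update b n c i = b i := fun i hi =>
      Function.update_of_ne hi.ne _ _
    rcases hm.lt_or_eq with h | rfl
    · rw [← hb m h]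
      exact Finset.sum_congr rfl fun i hi => by
        rw [hlt i (by have := Finset.mem_range.mp hi; omega)]
    · rw [ghost, Finset.sum_range_succ, Finset.sum_congr rfl fun i hi => by
        rw [hlt i (Finset.mem_range.mp hi)]]
      simp [← hc]
  choose! c hc using key
  let s : ℕ → ℕ → B := fun n => Nat.rec (fun _ => 0) (fun n b => Function.update b n (c n b)) n
  have hs : ∀ n, s (n + 1) = Function.update (s n) n (c n (s n)) := fun n => rfl
  have hg : ∀ n, ∀ m < n, ghost w q (s n) m = a m := by
    intro n
    induction n with
    | zero => intro m hm; omega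
    | succ n ih => intro m hm; rw [hs]; exact hc n (s n) ih m (Nat.lt_succ_iff.mp hm)
  have hst : ∀ n i, i < n → s n i = s (i + 1) i := by
    intro n i hi
    induction n with
    | zero => omega
    | succ n ih =>
      rcases (Nat.lt_succ_iff.mp hi).lt_or_eq with h | rfl
      · rw [hs, Function.update_of_ne h.ne, ih h]
      · rfl
  refine ⟨fun i => s (i + 1) i, fun n => ?_⟩
  rw [← hg (n + 1) n (Nat.lt_succ_self n)]
  exact Finset.sum_congr rfl fun i hi => by rw [hst (n + 1) i (Finset.mem_range.mp hi)]

theorem ghost_injective {w : B} (hw : w ∈ nonZeroDivisors B) (q : ℕ) {b c : ℕ → B}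
    (h : ∀ n, ghost w q b n = ghost w q c n) : b = c := by
  funext n
  induction n using Nat.strong_induction_on with
  | _ n ih =>
    have := h n
    rw [ghost, ghost, Finset.sum_range_succ, Finset.sum_range_succ,
      Finset.sum_congr rfl fun i hi => by rw [ih i (Finset.mem_range.mp hi)]] at this
    have h2 := add_left_cancel this
    simp only [Nat.sub_self, pow_zero, pow_one] at h2
    exact (mul_cancel_left_mem_nonZeroDivisors (pow_mem hw n)).mp h2

end Congruence

/-! ### The base ring -/

section Base

variable {O : Type u} [CommRing O] [IsDomain O] [IsDiscreteValuationRing O]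
  [Finite (ResidueField O)]

theorem uniformizer_dvd_iff (ϖ : Uniformizer O) (x : O) : ϖ.1 ∣ x ↔ residue O x = 0 := by
  rw [residue_eq_zero_iff, ϖ.2.maximalIdeal_eq, Ideal.mem_span_singleton]

theorem uniformizer_dvd_sub_iff (ϖ : Uniformizer O) (x y : O) :
    ϖ.1 ∣ x - y ↔ residue O x = residue O y := by
  rw [uniformizer_dvd_iff, map_sub, sub_eq_zero]

theorem card_pos_exponent (p : ℕ) [Fact p.Prime] [CharP (ResidueField O) p] :
    Nat.card (ResidueField O) = p ^ Nat.log p (Nat.card (ResidueField O)) ∧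
      0 < Nat.log p (Nat.card (ResidueField O)) := by
  have := Fintype.ofFinite (ResidueField O)
  obtain ⟨n, -, hn⟩ := FiniteField.card (ResidueField O) p
  rw [Nat.card_eq_fintype_card, hn, Nat.log_pow (Fact.out : p.Prime).one_lt]
  exact ⟨rfl, n.2⟩

theorem residue_pow_card (x : ResidueField O) : x ^ Nat.card (ResidueField O) = x := by
  have := Fintype.ofFinite (ResidueField O)
  rw [Nat.card_eq_fintype_card, FiniteField.pow_card]

theorem dvd_prime (ϖ : Uniformizer O) (p : ℕ) [CharP (ResidueField O) p] : ϖ.1 ∣ (p : O) := by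
  rw [uniformizer_dvd_iff, map_natCast, CharP.cast_eq_zero]

theorem dvd_card (ϖ : Uniformizer O) : ϖ.1 ∣ (Nat.card (ResidueField O) : O) := by
  have := Fintype.ofFinite (ResidueField O)
  rw [uniformizer_dvd_iff, map_natCast, Nat.card_eq_fintype_card, FiniteField.cast_card_eq_zero]

theorem dvd_pow_card_sub (ϖ : Uniformizer O) (x : O) :
    ϖ.1 ∣ x - x ^ Nat.card (ResidueField O) := by
  rw [uniformizer_dvd_sub_iff, map_pow, residue_pow_card]

/-- The lift of the `q`-Frobenius to a polynomial ring that raises the variables to the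
power `q`. -/
def frobLift (O : Type u) [CommRing O] [IsLocalRing O] (I : Type*) :
    MvPolynomial I O →ₐ[O] MvPolynomial I O :=
  MvPolynomial.aeval fun i => MvPolynomial.X i ^ Nat.card (ResidueField O)

theorem dvd_frobLift_sub (ϖ : Uniformizer O) {I : Type*} (b : MvPolynomial I O) :
    algebraMap O (MvPolynomial I O) ϖ.1 ∣ frobLift O I b - b ^ Nat.card (ResidueField O) := by
  obtain ⟨p, hp⟩ := CharP.exists (ResidueField O)
  have hpp : Fact p.Prime := ⟨(CharP.char_is_prime_or_zero (ResidueField O) p).resolve_right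
    (CharP.char_ne_zero_of_finite (ResidueField O) p)⟩
  obtain ⟨hq, -⟩ := card_pos_exponent (O := O) p
  have hdp : algebraMap O (MvPolynomial I O) ϖ.1 ∣ (p : MvPolynomial I O) := by
    simpa using map_dvd (algebraMap O (MvPolynomial I O)) (dvd_prime ϖ p)
  induction b using MvPolynomial.induction_on with
  | C a =>
    have : frobLift O I (MvPolynomial.C a) = MvPolynomial.C a := by
      simp [frobLift, MvPolynomial.algebraMap_eq]
    rw [this, ← map_pow, ← map_sub, ← MvPolynomial.algebraMap_eq]
    exact map_dvd _ (dvd_pow_card_sub ϖ a)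
  | add a b ha hb =>
    have h : algebraMap O (MvPolynomial I O) ϖ.1 ∣
        (a + b) ^ Nat.card (ResidueField O) -
          (a ^ Nat.card (ResidueField O) + b ^ Nat.card (ResidueField O)) := by
      rw [hq]
      obtain ⟨r, hr⟩ := exists_add_pow_prime_pow_eq hpp.out a b
        (Nat.log p (Nat.card (ResidueField O)))
      rw [hr, add_sub_cancel_left, mul_assoc, mul_assoc]
      exact hdp.mul_right _
    have h2 := dvd_sub (dvd_add ha hb) h
    rw [map_add]
    convert h2 using 1
    ring
  | mul_X a i ha =>
    rw [map_mul, mul_pow, show frobLift O I (MvPolynomial.X i) =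
      MvPolynomial.X i ^ Nat.card (ResidueField O) by simp [frobLift], ← sub_mul]
    exact ha.mul_right _

theorem algebraMap_uniformizer_mem (ϖ : Uniformizer O) (I : Type*) :
    algebraMap O (MvPolynomial I O) ϖ.1 ∈ nonZeroDivisors (MvPolynomial I O) := by
  rw [mem_nonZeroDivisors_iff_ne_zero, MvPolynomial.algebraMap_eq, Ne, MvPolynomial.C_eq_zero]
  exact ϖ.2.ne_zero

theorem exists_polynomials (ϖ : Uniformizer O) {I : Type*} (a : ℕ → MvPolynomial I O)
    (ha : ∀ n, algebraMap O (MvPolynomial I O) ϖ.1 ^ (n + 1) ∣ a (n + 1) - frobLift O I (a n)) :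
    ∃ b : ℕ → MvPolynomial I O, ∀ n,
      ghost (algebraMap O _ ϖ.1) (Nat.card (ResidueField O)) b n = a n :=
  exists_ghost_eq (σ := (frobLift O I : MvPolynomial I O →+* MvPolynomial I O))
    ((frobLift O I).commutes _) (by simpa using map_dvd (algebraMap O (MvPolynomial I O)) (dvd_card ϖ))
    (dvd_frobLift_sub ϖ) a ha

theorem dvd_ghost_X (ϖ : Uniformizer O) {I : Type*} (b : ℕ → MvPolynomial I O) (n : ℕ) :
    algebraMap O (MvPolynomial I O) ϖ.1 ^ (n + 1) ∣
      ghost (algebraMap O _ ϖ.1) (Nat.card (ResidueField O)) b (n + 1) -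
        frobLift O I (ghost (algebraMap O _ ϖ.1) (Nat.card (ResidueField O)) b n) :=
  pow_dvd_ghost_succ_sub (σ := (frobLift O I : MvPolynomial I O →+* MvPolynomial I O))
    ((frobLift O I).commutes _) (by simpa using map_dvd (algebraMap O (MvPolynomial I O)) (dvd_card ϖ))
    (dvd_frobLift_sub ϖ) b n

end Base

end RamifiedWitt

namespace RamifiedWitt

/-! ### Structure polynomials -/

section Polynomials

variable {O : Type u} [CommRing O] [IsDomain O] [IsDiscreteValuationRing O]
  [Finite (ResidueField O)]

/-- The ghost components, with respect to the uniformizer `ϖ`, of a sequence in an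
`O`-algebra. -/
abbrev gh (ϖ : Uniformizer O) {B : Type v} [CommRing B] [Algebra O B] (b : ℕ → B) (n : ℕ) : B :=
  ghost (algebraMap O B ϖ.1) (Nat.card (ResidueField O)) b n

theorem exists_addPoly (ϖ : Uniformizer O) : ∃ S : ℕ → MvPolynomial (ℕ ⊕ ℕ) O, ∀ n,
    gh ϖ S n = gh ϖ (fun i => MvPolynomial.X (Sum.inl i)) n +
      gh ϖ (fun i => MvPolynomial.X (Sum.inr i)) n := by
  refine exists_polynomials ϖ _ fun n => ?_
  rw [map_add, add_sub_add_comm]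
  exact dvd_add (dvd_ghost_X ϖ _ n) (dvd_ghost_X ϖ _ n)

theorem exists_mulPoly (ϖ : Uniformizer O) : ∃ M : ℕ → MvPolynomial (ℕ ⊕ ℕ) O, ∀ n,
    gh ϖ M n = gh ϖ (fun i => MvPolynomial.X (Sum.inl i)) n *
      gh ϖ (fun i => MvPolynomial.X (Sum.inr i)) n := by
  refine exists_polynomials ϖ _ fun n => ?_
  rw [map_mul]
  exact dvd_mul_sub_mul (dvd_ghost_X ϖ _ n) (dvd_ghost_X ϖ _ n)

theorem exists_negPoly (ϖ : Uniformizer O) : ∃ N : ℕ → MvPolynomial ℕ O, ∀ n,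
    gh ϖ N n = -gh ϖ (fun i => MvPolynomial.X i) n := by
  refine exists_polynomials ϖ _ fun n => ?_
  rw [map_neg, ← neg_sub_neg, neg_neg, neg_neg, ← dvd_neg, neg_sub]
  exact dvd_ghost_X ϖ _ n

/-- The polynomials giving the sum of ramified Witt vectors. -/
def addPoly (ϖ : Uniformizer O) : ℕ → MvPolynomial (ℕ ⊕ ℕ) O := (exists_addPoly ϖ).choose

/-- The polynomials giving the product of ramified Witt vectors. -/
def mulPoly (ϖ : Uniformizer O) : ℕ → MvPolynomial (ℕ ⊕ ℕ) O := (exists_mulPoly ϖ).choose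

/-- The polynomials giving the opposite of a ramified Witt vector. -/
def negPoly (ϖ : Uniformizer O) : ℕ → MvPolynomial ℕ O := (exists_negPoly ϖ).choose

theorem gh_map (ϖ : Uniformizer O) {B C : Type*} [CommRing B] [CommRing C] [Algebra O B]
    [Algebra O C] (f : B →ₐ[O] C) (b : ℕ → B) (n : ℕ) :
    f (gh ϖ b n) = gh ϖ (fun i => f (b i)) n := by
  have := map_ghost (f : B →+* C) (algebraMap O B ϖ.1) (Nat.card (ResidueField O)) b n
  simpa using this

end Polynomials

end RamifiedWitt

/-! ### Ramified Witt vectors -/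

/-- The set `W_O(B)` of ramified Witt vectors with coefficients in an `O`-algebra `B`,
with respect to the uniformizer `ϖ` of `O`. -/
@[ext]
structure RWitt {O : Type u} [CommRing O] (ϖ : Uniformizer O) (B : Type v) where
  /-- The components of a ramified Witt vector. -/
  coeff : ℕ → B

namespace RWitt

open RamifiedWitt

variable {O : Type u} [CommRing O] [IsDomain O] [IsDiscreteValuationRing O]
  [Finite (ResidueField O)] {ϖ : Uniformizer O}

section Ring

variable {B : Type v} {C : Type*} [CommRing B] [Algebra O B] [CommRing C] [Algebra O C]

instance : Zero (RWitt ϖ B) := ⟨⟨fun _ => 0⟩⟩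

instance : One (RWitt ϖ B) := ⟨⟨fun n => if n = 0 then 1 else 0⟩⟩

instance : Add (RWitt ϖ B) :=
  ⟨fun x y => ⟨fun n => MvPolynomial.aeval (Sum.elim x.coeff y.coeff) (addPoly ϖ n)⟩⟩

instance : Mul (RWitt ϖ B) :=
  ⟨fun x y => ⟨fun n => MvPolynomial.aeval (Sum.elim x.coeff y.coeff) (mulPoly ϖ n)⟩⟩

instance : Neg (RWitt ϖ B) :=
  ⟨fun x => ⟨fun n => MvPolynomial.aeval x.coeff (negPoly ϖ n)⟩⟩

/-- The ghost map `Φ_B`. -/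
def ghostFun (x : RWitt ϖ B) (n : ℕ) : B := gh ϖ x.coeff n

theorem ghostFun_zero (n : ℕ) : ghostFun (0 : RWitt ϖ B) n = 0 := by
  have hq : Nat.card (ResidueField O) ≠ 0 := Nat.card_pos.ne'
  rw [ghostFun, gh, ghost]
  refine Finset.sum_eq_zero fun i _ => ?_
  change _ * (0 : B) ^ _ = 0
  rw [zero_pow (pow_ne_zero _ hq), mul_zero]

theorem ghostFun_one (n : ℕ) : ghostFun (1 : RWitt ϖ B) n = 1 := by
  have hq : Nat.card (ResidueField O) ≠ 0 := Nat.card_pos.ne'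
  have h : ∀ i, (1 : RWitt ϖ B).coeff i = if i = 0 then 1 else 0 := fun i => rfl
  rw [ghostFun, gh, ghost, Finset.sum_range_succ', Finset.sum_eq_zero]
  · simp [h]
  · intro i _
    rw [h, if_neg (Nat.succ_ne_zero i), zero_pow (pow_ne_zero _ hq), mul_zero]

theorem ghostFun_add (x y : RWitt ϖ B) (n : ℕ) :
    ghostFun (x + y) n = ghostFun x n + ghostFun y n := by
  have h := congrArg (MvPolynomial.aeval (Sum.elim x.coeff y.coeff))
    ((exists_addPoly ϖ).choose_spec n)
  rw [map_add, gh_map, gh_map, gh_map] at h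
  simp only [MvPolynomial.aeval_X, Sum.elim_inl, Sum.elim_inr] at h
  exact h

theorem ghostFun_mul (x y : RWitt ϖ B) (n : ℕ) :
    ghostFun (x * y) n = ghostFun x n * ghostFun y n := by
  have h := congrArg (MvPolynomial.aeval (Sum.elim x.coeff y.coeff))
    ((exists_mulPoly ϖ).choose_spec n)
  rw [map_mul, gh_map, gh_map, gh_map] at h
  simp only [MvPolynomial.aeval_X, Sum.elim_inl, Sum.elim_inr] at h
  exact h

theorem ghostFun_neg (x : RWitt ϖ B) (n : ℕ) : ghostFun (-x) n = -ghostFun x n := by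
  have h := congrArg (MvPolynomial.aeval x.coeff) ((exists_negPoly ϖ).choose_spec n)
  rw [map_neg, gh_map, gh_map] at h
  simp only [MvPolynomial.aeval_X] at h
  exact h

theorem ghostFun_injective (hB : algebraMap O B ϖ.1 ∈ nonZeroDivisors B) {x y : RWitt ϖ B}
    (h : ∀ n, ghostFun x n = ghostFun y n) : x = y :=
  RWitt.ext (ghost_injective hB _ h)

/-- The map on ramified Witt vectors induced by a homomorphism of `O`-algebras. -/
def mapFun (f : B →ₐ[O] C) (x : RWitt ϖ B) : RWitt ϖ C := ⟨fun n => f (x.coeff n)⟩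

theorem mapFun_zero (f : B →ₐ[O] C) : mapFun f (0 : RWitt ϖ B) = 0 :=
  RWitt.ext (funext fun _ => map_zero f)

theorem mapFun_one (f : B →ₐ[O] C) : mapFun f (1 : RWitt ϖ B) = 1 := by
  refine RWitt.ext (funext fun n => ?_)
  change f (if n = 0 then 1 else 0) = if n = 0 then 1 else 0
  split_ifs <;> simp

theorem map_aeval_sum (f : B →ₐ[O] C) (x y : ℕ → B) (P : MvPolynomial (ℕ ⊕ ℕ) O) :
    f (MvPolynomial.aeval (Sum.elim x y) P) =
      MvPolynomial.aeval (Sum.elim (fun n => f (x n)) (fun n => f (y n))) P := by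
  rw [← AlgHom.comp_apply, MvPolynomial.comp_aeval]
  congr 2
  funext i
  cases i <;> rfl

theorem mapFun_add (f : B →ₐ[O] C) (x y : RWitt ϖ B) :
    mapFun f (x + y) = mapFun f x + mapFun f y :=
  RWitt.ext (funext fun _ => map_aeval_sum f _ _ _)

theorem mapFun_mul (f : B →ₐ[O] C) (x y : RWitt ϖ B) :
    mapFun f (x * y) = mapFun f x * mapFun f y :=
  RWitt.ext (funext fun _ => map_aeval_sum f _ _ _)

theorem mapFun_neg (f : B →ₐ[O] C) (x : RWitt ϖ B) : mapFun f (-x) = -mapFun f x :=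
  RWitt.ext (funext fun n => by
    change f (MvPolynomial.aeval _ _) = MvPolynomial.aeval _ _
    rw [← AlgHom.comp_apply, MvPolynomial.comp_aeval]
    rfl)

variable (O B) in
/-- Every `O`-algebra is a quotient of a polynomial ring over `O`. -/
def cover : MvPolynomial B O →ₐ[O] B := MvPolynomial.aeval id

theorem exists_mapFun_cover (x : RWitt ϖ B) :
    ∃ y : RWitt ϖ (MvPolynomial B O), mapFun (cover O B) y = x :=
  ⟨⟨fun n => MvPolynomial.X (x.coeff n)⟩, RWitt.ext (funext fun n => by simp [cover, mapFun])⟩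

theorem ghostFun_injective_cover {x y : RWitt ϖ (MvPolynomial B O)}
    (h : ∀ n, ghostFun x n = ghostFun y n) : x = y :=
  ghostFun_injective (algebraMap_uniformizer_mem ϖ B) h

/-- The ring structure on `W_O(B)`: it is natural in `B` and makes the ghost map a ring
homomorphism. -/
instance : CommRing (RWitt ϖ B) where
  add_assoc x y z := by
    obtain ⟨x, rfl⟩ := exists_mapFun_cover x
    obtain ⟨y, rfl⟩ := exists_mapFun_cover y
    obtain ⟨z, rfl⟩ := exists_mapFun_cover z
    simp only [← mapFun_add]
    exact congrArg _ (ghostFun_injective_cover fun n => by simp only [ghostFun_add, add_assoc])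
  zero_add x := by
    obtain ⟨x, rfl⟩ := exists_mapFun_cover x
    rw [← mapFun_zero (cover O B), ← mapFun_add]
    exact congrArg _ (ghostFun_injective_cover fun n => by
      simp only [ghostFun_add, ghostFun_zero, zero_add])
  add_zero x := by
    obtain ⟨x, rfl⟩ := exists_mapFun_cover x
    rw [← mapFun_zero (cover O B), ← mapFun_add]
    exact congrArg _ (ghostFun_injective_cover fun n => by
      simp only [ghostFun_add, ghostFun_zero, add_zero])
  add_comm x y := by
    obtain ⟨x, rfl⟩ := exists_mapFun_cover x
    obtain ⟨y, rfl⟩ := exists_mapFun_cover y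
    simp only [← mapFun_add]
    exact congrArg _ (ghostFun_injective_cover fun n => by simp only [ghostFun_add, add_comm])
  neg_add_cancel x := by
    obtain ⟨x, rfl⟩ := exists_mapFun_cover x
    rw [← mapFun_zero (cover O B), ← mapFun_neg, ← mapFun_add]
    exact congrArg _ (ghostFun_injective_cover fun n => by
      simp only [ghostFun_add, ghostFun_neg, ghostFun_zero, neg_add_cancel])
  mul_assoc x y z := by
    obtain ⟨x, rfl⟩ := exists_mapFun_cover x
    obtain ⟨y, rfl⟩ := exists_mapFun_cover y
    obtain ⟨z, rfl⟩ := exists_mapFun_cover z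
    simp only [← mapFun_mul]
    exact congrArg _ (ghostFun_injective_cover fun n => by simp only [ghostFun_mul, mul_assoc])
  mul_comm x y := by
    obtain ⟨x, rfl⟩ := exists_mapFun_cover x
    obtain ⟨y, rfl⟩ := exists_mapFun_cover y
    simp only [← mapFun_mul]
    exact congrArg _ (ghostFun_injective_cover fun n => by simp only [ghostFun_mul, mul_comm])
  one_mul x := by
    obtain ⟨x, rfl⟩ := exists_mapFun_cover x
    rw [← mapFun_one (cover O B), ← mapFun_mul]
    exact congrArg _ (ghostFun_injective_cover fun n => by
      simp only [ghostFun_mul, ghostFun_one, one_mul])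
  mul_one x := by
    obtain ⟨x, rfl⟩ := exists_mapFun_cover x
    rw [← mapFun_one (cover O B), ← mapFun_mul]
    exact congrArg _ (ghostFun_injective_cover fun n => by
      simp only [ghostFun_mul, ghostFun_one, mul_one])
  left_distrib x y z := by
    obtain ⟨x, rfl⟩ := exists_mapFun_cover x
    obtain ⟨y, rfl⟩ := exists_mapFun_cover y
    obtain ⟨z, rfl⟩ := exists_mapFun_cover z
    simp only [← mapFun_mul, ← mapFun_add]
    exact congrArg _ (ghostFun_injective_cover fun n => by
      simp only [ghostFun_mul, ghostFun_add, left_distrib])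
  right_distrib x y z := by
    obtain ⟨x, rfl⟩ := exists_mapFun_cover x
    obtain ⟨y, rfl⟩ := exists_mapFun_cover y
    obtain ⟨z, rfl⟩ := exists_mapFun_cover z
    simp only [← mapFun_mul, ← mapFun_add]
    exact congrArg _ (ghostFun_injective_cover fun n => by
      simp only [ghostFun_mul, ghostFun_add, right_distrib])
  zero_mul x := by
    obtain ⟨x, rfl⟩ := exists_mapFun_cover x
    rw [← mapFun_zero (cover O B), ← mapFun_mul]
    exact congrArg _ (ghostFun_injective_cover fun n => by
      simp only [ghostFun_mul, ghostFun_zero, zero_mul])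
  mul_zero x := by
    obtain ⟨x, rfl⟩ := exists_mapFun_cover x
    rw [← mapFun_zero (cover O B), ← mapFun_mul]
    exact congrArg _ (ghostFun_injective_cover fun n => by
      simp only [ghostFun_mul, ghostFun_zero, mul_zero])
  nsmul := nsmulRec
  zsmul := zsmulRec

/-- Functoriality of `W_O`. -/
def map (f : B →ₐ[O] C) : RWitt ϖ B →+* RWitt ϖ C where
  toFun := mapFun f
  map_zero' := mapFun_zero f
  map_one' := mapFun_one f
  map_add' := mapFun_add f
  map_mul' := mapFun_mul f

theorem map_coeff (f : B →ₐ[O] C) (x : RWitt ϖ B) (n : ℕ) :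
    (map f x).coeff n = f (x.coeff n) := rfl

end Ring

/-! ### The structure of `O`-algebra on `W_O(B)` -/

section Algebra

theorem exists_scalar (ϖ : Uniformizer O) (c : O) : ∃ b : ℕ → O, ∀ n, gh ϖ b n = c :=
  exists_ghost_eq (σ := RingHom.id O) rfl (dvd_card ϖ) (dvd_pow_card_sub ϖ) (fun _ => c)
    fun n => by simp

/-- The homomorphism `O → W_O(O)` whose ghost components are all the identity. -/
def scalar (ϖ : Uniformizer O) : O →+* RWitt ϖ O where
  toFun c := ⟨(exists_scalar ϖ c).choose⟩
  map_zero' := ghostFun_injective (mem_nonZeroDivisors_of_ne_zero ϖ.2.ne_zero) fun n => by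
    rw [ghostFun_zero]; exact (exists_scalar ϖ 0).choose_spec n
  map_one' := ghostFun_injective (mem_nonZeroDivisors_of_ne_zero ϖ.2.ne_zero) fun n => by
    rw [ghostFun_one]; exact (exists_scalar ϖ 1).choose_spec n
  map_add' x y := ghostFun_injective (mem_nonZeroDivisors_of_ne_zero ϖ.2.ne_zero) fun n => by
    rw [ghostFun_add, ghostFun, ghostFun, ghostFun, (exists_scalar ϖ _).choose_spec,
      (exists_scalar ϖ _).choose_spec, (exists_scalar ϖ _).choose_spec]
  map_mul' x y := ghostFun_injective (mem_nonZeroDivisors_of_ne_zero ϖ.2.ne_zero) fun n => by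
    rw [ghostFun_mul, ghostFun, ghostFun, ghostFun, (exists_scalar ϖ _).choose_spec,
      (exists_scalar ϖ _).choose_spec, (exists_scalar ϖ _).choose_spec]

theorem ghostFun_scalar (ϖ : Uniformizer O) (c : O) (n : ℕ) : ghostFun (scalar ϖ c) n = c :=
  (exists_scalar ϖ c).choose_spec n

/-- The structure of `O`-algebra on `W_O(B)`, for which the ghost map is a homomorphism
of `O`-algebras. -/
instance (B : Type v) [CommRing B] [Algebra O B] : Algebra O (RWitt ϖ B) :=
  ((map (Algebra.ofId O B)).comp (scalar ϖ)).toAlgebra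

theorem algebraMap_coeff {B : Type v} [CommRing B] [Algebra O B] (c : O) (n : ℕ) :
    (algebraMap O (RWitt ϖ B) c).coeff n = algebraMap O B ((scalar ϖ c).coeff n) := rfl

theorem map_algebraMap {B : Type v} {C : Type*} [CommRing B] [Algebra O B] [CommRing C]
    [Algebra O C] (f : B →ₐ[O] C) (c : O) :
    map f (algebraMap O (RWitt ϖ B) c) = algebraMap O (RWitt ϖ C) c :=
  RWitt.ext (funext fun n => by rw [map_coeff, algebraMap_coeff, algebraMap_coeff, f.commutes])

end Algebra

/-! ### The Drinfeld map -/

section Drinfeld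

variable (p : ℕ) [Fact p.Prime] [CharP (ResidueField O) p]

theorem exists_drinfeldPoly (ϖ : Uniformizer O) : ∃ U : ℕ → MvPolynomial ℕ O, ∀ n,
    gh ϖ U n = ghost (p : MvPolynomial ℕ O) p MvPolynomial.X
      (Nat.log p (Nat.card (ResidueField O)) * n) := by
  obtain ⟨hq, hh⟩ := card_pos_exponent (O := O) p
  have hp : algebraMap O (MvPolynomial ℕ O) ϖ.1 ∣ (p : MvPolynomial ℕ O) := by
    simpa using map_dvd (algebraMap O (MvPolynomial ℕ O)) (dvd_prime ϖ p)
  refine exists_polynomials ϖ _ fun n => ?_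
  have hF := dvd_frobLift_sub ϖ (I := ℕ)
  generalize Nat.log p (Nat.card (ResidueField O)) = h at hq hh
  set w := algebraMap O (MvPolynomial ℕ O) ϖ.1
  have hle : n ≤ h * n := Nat.le_mul_of_pos_left n hh
  have hlt : h * n + 1 ≤ h * (n + 1) + 1 := by rw [Nat.mul_succ]; omega
  have hmap := map_ghost (frobLift O ℕ : MvPolynomial ℕ O →+* MvPolynomial ℕ O)
    (p : MvPolynomial ℕ O) p MvPolynomial.X (h * n)
  rw [RingHom.coe_coe] at hmap
  rw [hmap, ghost, ← Finset.sum_range_add_sum_Ico _ hlt, ghost, add_sub_right_comm,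
    ← Finset.sum_sub_distrib]
  refine dvd_add (Finset.dvd_sum fun i hi => ?_) (Finset.dvd_sum fun i hi => ?_)
  · have hi : i ≤ h * n := Nat.lt_succ_iff.mp (Finset.mem_range.mp hi)
    rw [map_natCast, ← mul_sub, Nat.mul_succ, show h * n + h - i = h + (h * n - i) by omega,
      pow_add p, ← hq, pow_mul]
    refine (pow_dvd_pow w (show n + 1 ≤ i + (h * n - i + 1) by omega)).trans ?_
    rw [pow_add]
    refine mul_dvd_mul (pow_dvd_pow_of_dvd hp i) ?_
    rw [← dvd_neg, neg_sub]
    exact pow_dvd_pow_sub_pow hp (hF _) _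
  · have hi : h * n + 1 ≤ i := (Finset.mem_Ico.mp hi).1
    exact ((pow_dvd_pow w (show n + 1 ≤ i by omega)).trans (pow_dvd_pow_of_dvd hp i)).mul_right _

/-- The polynomials giving the Drinfeld map `W(B) → W_O(B)`. -/
def drinfeldPoly (ϖ : Uniformizer O) : ℕ → MvPolynomial ℕ O := (exists_drinfeldPoly p ϖ).choose

variable {B : Type v} {C : Type*} [CommRing B] [Algebra O B] [CommRing C] [Algebra O C]

/-- The Drinfeld map `W(B) → W_O(B)` as a map of sets. -/
def drinfeldFun (ϖ : Uniformizer O) (x : WittVector p B) : RWitt ϖ B :=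
  ⟨fun n => MvPolynomial.aeval x.coeff (drinfeldPoly p ϖ n)⟩

theorem ghostFun_drinfeldFun (x : WittVector p B) (n : ℕ) :
    ghostFun (drinfeldFun p ϖ x) n =
      WittVector.ghostComponent (Nat.log p (Nat.card (ResidueField O)) * n) x := by
  have h := congrArg (MvPolynomial.aeval x.coeff) ((exists_drinfeldPoly p ϖ).choose_spec n)
  have h2 := map_ghost (MvPolynomial.aeval (R := O) x.coeff : MvPolynomial ℕ O →+* B)
    (p : MvPolynomial ℕ O) p MvPolynomial.X (Nat.log p (Nat.card (ResidueField O)) * n)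
  rw [RingHom.coe_coe] at h2
  rw [gh_map, h2] at h
  simp only [MvPolynomial.aeval_X, map_natCast] at h
  refine h.trans ?_
  rw [WittVector.ghostComponent_apply, aeval_wittPolynomial, ghost]

theorem mapFun_drinfeldFun (f : B →ₐ[O] C) (x : WittVector p B) :
    mapFun f (drinfeldFun p ϖ x) = drinfeldFun p ϖ (WittVector.map (f : B →+* C) x) :=
  RWitt.ext (funext fun n => by
    change f (MvPolynomial.aeval _ _) = MvPolynomial.aeval _ _
    rw [← AlgHom.comp_apply, MvPolynomial.comp_aeval]
    congr 2)

theorem exists_map_cover (x : WittVector p B) :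
    ∃ y : WittVector p (MvPolynomial B O),
      WittVector.map (cover O B : MvPolynomial B O →+* B) y = x :=
  WittVector.map_surjective _ (fun b => ⟨MvPolynomial.X b, by simp [cover]⟩) x

/-- The Drinfeld map `u : W(B) → W_O(B)`, for which `Φ_n (u x)` is the `(h * n)`-th ghost
component of `x`, where the residue field of `O` has `p ^ h` elements. -/
def drinfeld (ϖ : Uniformizer O) (B : Type v) [CommRing B] [Algebra O B] :
    WittVector p B →+* RWitt ϖ B where
  toFun := drinfeldFun p ϖ
  map_zero' := by
    rw [← map_zero (WittVector.map (cover O B : MvPolynomial B O →+* B)), ← mapFun_drinfeldFun,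
      ← mapFun_zero (cover O B)]
    exact congrArg _ (ghostFun_injective_cover fun n => by
      rw [ghostFun_drinfeldFun, map_zero, ghostFun_zero])
  map_one' := by
    rw [← map_one (WittVector.map (cover O B : MvPolynomial B O →+* B)), ← mapFun_drinfeldFun,
      ← mapFun_one (cover O B)]
    exact congrArg _ (ghostFun_injective_cover fun n => by
      rw [ghostFun_drinfeldFun, map_one, ghostFun_one])
  map_add' x y := by
    obtain ⟨x, rfl⟩ := exists_map_cover (O := O) p x
    obtain ⟨y, rfl⟩ := exists_map_cover (O := O) p y
    rw [← map_add]
    simp only [← mapFun_drinfeldFun, ← mapFun_add]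
    exact congrArg _ (ghostFun_injective_cover fun n => by
      simp only [ghostFun_drinfeldFun, map_add, ghostFun_add])
  map_mul' x y := by
    obtain ⟨x, rfl⟩ := exists_map_cover (O := O) p x
    obtain ⟨y, rfl⟩ := exists_map_cover (O := O) p y
    rw [← map_mul]
    simp only [← mapFun_drinfeldFun, ← mapFun_mul]
    exact congrArg _ (ghostFun_injective_cover fun n => by
      simp only [ghostFun_drinfeldFun, map_mul, ghostFun_mul])

theorem map_drinfeld (f : B →ₐ[O] C) (x : WittVector p B) :
    map f (drinfeld p ϖ B x) = drinfeld p ϖ C (WittVector.map (f : B →+* C) x) :=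
  mapFun_drinfeldFun p f x

theorem drinfeld_coeff_zero (x : WittVector p B) : (drinfeld p ϖ B x).coeff 0 = x.coeff 0 := by
  change (drinfeldFun p ϖ x).coeff 0 = _
  have := ghostFun_drinfeldFun p (ϖ := ϖ) x 0
  simpa [ghostFun, gh, ghost, WittVector.ghostComponent_apply, wittPolynomial_zero] using this

end Drinfeld

end RWitt

/-! ### The canonical homomorphism `W(k) → O` -/

namespace RamifiedWitt

section Base

variable {O : Type u} [CommRing O] [IsDomain O] [IsDiscreteValuationRing O]
  [Finite (ResidueField O)] [IsAdicComplete (maximalIdeal O) O]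

theorem gh_congr (ϖ : Uniformizer O) {b c : ℕ → O} {n : ℕ} (h : ∀ i ≤ n, ϖ.1 ∣ b i - c i) :
    ϖ.1 ^ (n + 1) ∣ gh ϖ b n - gh ϖ c n := by
  rw [gh, gh, ghost, ghost, ← Finset.sum_sub_distrib]
  refine Finset.dvd_sum fun i hi => ?_
  have hi : i ≤ n := Nat.lt_succ_iff.mp (Finset.mem_range.mp hi)
  rw [← mul_sub, show n + 1 = i + (n - i + 1) by omega, pow_add]
  exact mul_dvd_mul_left _ (pow_dvd_pow_sub_pow (dvd_card ϖ) (h i hi) _)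

theorem eq_of_forall_pow_dvd (ϖ : Uniformizer O) {x y : O} (h : ∀ n, ϖ.1 ^ n ∣ x - y) :
    x = y := by
  rw [← sub_eq_zero]
  refine IsHausdorff.haus (inferInstance : IsHausdorff (maximalIdeal O) O) _ fun n => ?_
  rw [SModEq.zero, smul_eq_mul, Ideal.mul_top, ϖ.2.maximalIdeal_eq, Ideal.span_singleton_pow,
    Ideal.mem_span_singleton]
  exact h n

theorem exists_limit (ϖ : Uniformizer O) (a : ℕ → O)
    (ha : ∀ n, ϖ.1 ^ (n + 1) ∣ a (n + 1) - a n) : ∃ x, ∀ n, ϖ.1 ^ (n + 1) ∣ x - a n := by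
  have hmem : ∀ (n : ℕ) (x y : O),
      x ≡ y [SMOD (maximalIdeal O ^ n • ⊤ : Submodule O O)] ↔ ϖ.1 ^ n ∣ x - y := by
    intro n x y
    rw [SModEq.sub_mem, smul_eq_mul, Ideal.mul_top, ϖ.2.maximalIdeal_eq,
      Ideal.span_singleton_pow, Ideal.mem_span_singleton]
  have hc : ∀ {m n}, m ≤ n → ϖ.1 ^ m ∣ a m - a n := by
    intro m n hmn
    induction n, hmn using Nat.le_induction with
    | base => simp
    | succ n hmn ih =>
      have := dvd_sub ih ((pow_dvd_pow ϖ.1 (show m ≤ n + 1 by omega)).trans (ha n))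
      rwa [sub_sub, add_sub_cancel] at this
  obtain ⟨x, hx⟩ := IsPrecomplete.prec (inferInstance : IsPrecomplete (maximalIdeal O) O)
    (f := a) fun hmn => (hmem _ _ _).mpr (hc hmn)
  refine ⟨x, fun n => ?_⟩
  have h1 := (hmem _ _ _).mp (hx (n + 1))
  have := dvd_sub (ha n) h1
  rw [sub_sub_sub_cancel_left] at this
  exact this

theorem bijective_algebraMap (ϖ : Uniformizer O) :
    Function.Bijective (algebraMap O (RWitt ϖ (ResidueField O))) := by
  have hgh : ∀ c n, gh ϖ (RWitt.scalar ϖ c).coeff n = c := RWitt.ghostFun_scalar ϖ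
  have hcoeff : ∀ c n, (algebraMap O (RWitt ϖ (ResidueField O)) c).coeff n =
      residue O ((RWitt.scalar ϖ c).coeff n) := fun c n => rfl
  constructor
  · intro c d hcd
    refine eq_of_forall_pow_dvd ϖ fun n => (pow_dvd_pow _ n.le_succ).trans ?_
    rw [← hgh c n, ← hgh d n]
    refine gh_congr ϖ fun i _ => ?_
    rw [uniformizer_dvd_sub_iff, ← hcoeff, ← hcoeff, hcd]
  · intro x
    choose b hb using fun n => residue_surjective (x.coeff n)
    obtain ⟨c, hc⟩ := exists_limit ϖ (gh ϖ b) fun n =>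
      pow_dvd_ghost_succ_sub (σ := RingHom.id O) rfl (dvd_card ϖ) (dvd_pow_card_sub ϖ) b n
    have key : ∀ n, ϖ.1 ∣ (RWitt.scalar ϖ c).coeff n - b n := by
      intro n
      induction n using Nat.strong_induction_on with
      | _ n ih =>
        have h1 := hc n
        rw [← hgh c n, gh, gh, ghost, ghost, Finset.sum_range_succ, Finset.sum_range_succ,
          add_sub_add_comm, ← Finset.sum_sub_distrib] at h1
        have h2 : ϖ.1 ^ (n + 1) ∣ ∑ i ∈ Finset.range n,
            (algebraMap O O ϖ.1 ^ i * (RWitt.scalar ϖ c).coeff i ^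
              Nat.card (ResidueField O) ^ (n - i) -
            algebraMap O O ϖ.1 ^ i * b i ^ Nat.card (ResidueField O) ^ (n - i)) := by
          refine Finset.dvd_sum fun i hi => ?_
          have hi := Finset.mem_range.mp hi
          rw [← mul_sub, show n + 1 = i + (n - i + 1) by omega, pow_add]
          exact mul_dvd_mul_left _ (pow_dvd_pow_sub_pow (dvd_card ϖ) (ih i hi) _)
        have h3 := (dvd_add_right h2).mp h1
        rw [Nat.sub_self, pow_zero, pow_one, pow_one, ← mul_sub, pow_succ] at h3
        exact (mul_dvd_mul_iff_left (pow_ne_zero n ϖ.2.ne_zero)).mp h3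
    refine ⟨c, RWitt.ext (funext fun n => ?_)⟩
    rw [hcoeff, ← hb, ← uniformizer_dvd_sub_iff ϖ]
    exact key n

variable (p : ℕ) [Fact p.Prime] [CharP (ResidueField O) p]

theorem exists_lift (ϖ : Uniformizer O) : ∃ f : WittVector p (ResidueField O) →+* O,
    (∀ x, residue O (f x) = x.coeff 0) ∧
      ∀ x, algebraMap O (RWitt ϖ (ResidueField O)) (f x) = RWitt.drinfeld p ϖ _ x := by
  let e := RingEquiv.ofBijective _ (bijective_algebraMap ϖ)
  have he : ∀ y, algebraMap O (RWitt ϖ (ResidueField O)) (e.symm y) = y :=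
    fun y => e.apply_symm_apply y
  refine ⟨(e.symm : _ →+* O).comp (RWitt.drinfeld p ϖ _), fun x => ?_, fun x => he _⟩
  have h0 : ∀ c, (algebraMap O (RWitt ϖ (ResidueField O)) c).coeff 0 = residue O c := by
    intro c
    have := RWitt.ghostFun_scalar ϖ c 0
    rw [RWitt.algebraMap_coeff]
    simp only [RWitt.ghostFun, gh, ghost] at this
    simp at this
    rw [this]
    rfl
  rw [← h0]
  refine Eq.trans ?_ (RWitt.drinfeld_coeff_zero p (ϖ := ϖ) x)
  exact congrArg (fun z => RWitt.coeff z 0) (he _)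

theorem lift_unique {f g : WittVector p (ResidueField O) →+* O}
    (hf : ∀ x, residue O (f x) = x.coeff 0) (hg : ∀ x, residue O (g x) = x.coeff 0) :
    f = g := by
  obtain ⟨ϖ, hϖ⟩ := IsDiscreteValuationRing.exists_irreducible O
  let ϖ' : Uniformizer O := ⟨ϖ, hϖ⟩
  have hT : ∀ c, f (WittVector.teichmuller p c) = g (WittVector.teichmuller p c) := by
    intro c
    refine eq_of_forall_pow_dvd ϖ' fun n => (pow_dvd_pow _ n.le_succ).trans ?_
    have hc : WittVector.teichmuller p c ^ Nat.card (ResidueField O) ^ n =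
        WittVector.teichmuller p c := by
      rw [← map_pow]
      congr 1
      induction n with
      | zero => simp
      | succ n ih => rw [pow_succ, pow_mul, ih, residue_pow_card]
    rw [← hc, map_pow, map_pow]
    refine pow_dvd_pow_sub_pow (dvd_card ϖ') ?_ n
    rw [uniformizer_dvd_sub_iff, hf, hg]
  ext x
  refine eq_of_forall_pow_dvd ϖ' fun n => ?_
  have hnil : IsNilpotent (p : O ⧸ Ideal.span {ϖ ^ n}) := by
    refine ⟨n, ?_⟩
    rw [← map_natCast (Ideal.Quotient.mk _), ← map_pow, Ideal.Quotient.eq_zero_iff_mem,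
      Ideal.mem_span_singleton]
    exact pow_dvd_pow_of_dvd (dvd_prime ϖ' p) n
  have := RingHom.congr_fun (WittVector.eq_of_apply_teichmuller_eq
    ((Ideal.Quotient.mk (Ideal.span {ϖ ^ n})).comp f)
    ((Ideal.Quotient.mk (Ideal.span {ϖ ^ n})).comp g) hnil fun c => by simp [hT c]) x
  rwa [RingHom.comp_apply, RingHom.comp_apply, Ideal.Quotient.eq, Ideal.mem_span_singleton]
    at this

end Base

end RamifiedWitt

section WittLift

open RamifiedWitt

variable (p : ℕ) [Fact p.Prime] (O : Type u) [CommRing O] [IsDomain O]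
  [IsDiscreteValuationRing O] [Finite (ResidueField O)] [IsAdicComplete (maximalIdeal O) O]
  [CharP (ResidueField O) p]

theorem existsUnique_wittLift :
    ∃! f : WittVector p (ResidueField O) →+* O, ∀ x, residue O (f x) = x.coeff 0 := by
  obtain ⟨ϖ, hϖ⟩ := IsDiscreteValuationRing.exists_irreducible O
  obtain ⟨f, hf, -⟩ := exists_lift p (⟨ϖ, hϖ⟩ : Uniformizer O)
  exact ⟨f, hf, fun g hg => lift_unique p hg hf⟩

/-- The unique ring homomorphism `W(k) → O` that induces the identity on residue fields. -/
def wittLift : WittVector p (ResidueField O) →+* O := (existsUnique_wittLift p O).choose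

theorem residue_wittLift (x : WittVector p (ResidueField O)) :
    residue O (wittLift p O x) = x.coeff 0 :=
  (existsUnique_wittLift p O).choose_spec.1 x

/-- `O` as an algebra over `W(k)`. -/
@[reducible]
def wittAlgebra : Algebra (WittVector p (ResidueField O)) O := (wittLift p O).toAlgebra

theorem algebraMap_wittLift (ϖ : Uniformizer O) (x : WittVector p (ResidueField O)) :
    algebraMap O (RWitt ϖ (ResidueField O)) (wittLift p O x) = RWitt.drinfeld p ϖ _ x := by
  obtain ⟨f, hf, hf2⟩ := exists_lift p ϖ
  rw [lift_unique p (residue_wittLift p O) hf, hf2]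

attribute [local instance] wittAlgebra

theorem wittLift_injective [CharZero O] : Function.Injective (wittLift p O) := by
  rw [injective_iff_map_eq_zero]
  intro a ha
  by_contra h0
  obtain ⟨m, b, hb⟩ := WittVector.exists_eq_pow_p_mul' a h0
  rw [hb, map_mul, map_pow, map_natCast] at ha
  have h1 : (p : O) ≠ 0 := Nat.cast_ne_zero.mpr (Fact.out : p.Prime).ne_zero
  exact ((b.isUnit.map (wittLift p O)).ne_zero) ((mul_eq_zero.mp ha).resolve_left (pow_ne_zero _ h1))

theorem smodEq_span_pow_iff {R M : Type*} [CommRing R] [AddCommGroup M] [Module R M] (a : R)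
    (n : ℕ) (x y : M) :
    x ≡ y [SMOD (Ideal.span {a} ^ n • ⊤ : Submodule R M)] ↔ ∃ z, a ^ n • z = x - y := by
  rw [SModEq.sub_mem, Ideal.span_singleton_pow, Submodule.ideal_span_singleton_smul]
  simp [Submodule.mem_smul_pointwise_iff_exists]

theorem isPrecomplete_pi {R ι : Type*} [CommRing R] (a : R)
    [IsPrecomplete (Ideal.span {a}) R] : IsPrecomplete (Ideal.span {a}) (ι → R) := by
  refine ⟨fun f hf => ?_⟩
  have h : ∀ i, ∃ L, ∀ n, f n i ≡ L [SMOD (Ideal.span {a} ^ n • ⊤ : Submodule R R)] := by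
    intro i
    refine IsPrecomplete.prec (inferInstance : IsPrecomplete (Ideal.span {a}) R)
      (f := fun n => f n i) fun {m n} hmn => ?_
    obtain ⟨z, hz⟩ := (smodEq_span_pow_iff a m _ _).mp (hf hmn)
    exact (smodEq_span_pow_iff a m _ _).mpr ⟨z i, congrFun hz i⟩
  choose L hL using h
  refine ⟨L, fun n => (smodEq_span_pow_iff a n _ _).mpr ?_⟩
  choose z hz using fun i => (smodEq_span_pow_iff a n _ _).mp (hL i n)
  exact ⟨z, funext hz⟩

theorem exists_digits (ϖ : Uniformizer O) (x : O) (j : ℕ) :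
    ∃ y : ℕ → WittVector p (ResidueField O),
      ϖ.1 ^ j ∣ x - ∑ i ∈ Finset.range j, wittLift p O (y i) * ϖ.1 ^ i := by
  induction j with
  | zero => simp
  | succ j ih =>
    obtain ⟨y, z, hz⟩ := ih
    let t := WittVector.teichmuller p (residue O z)
    have ht : ϖ.1 ∣ z - wittLift p O t := by
      rw [uniformizer_dvd_sub_iff, residue_wittLift, WittVector.teichmuller_coeff_zero]
    refine ⟨Function.update y j t, ?_⟩
    rw [Finset.sum_range_succ, Function.update_self, Finset.sum_congr rfl fun i hi => by
      rw [Function.update_of_ne (Finset.mem_range.mp hi).ne], ← sub_sub, hz, mul_comm, ← sub_mul,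
      mul_comm, pow_succ]
    exact mul_dvd_mul_left _ ht

theorem finite_wittAlgebra [CharZero O] : Module.Finite (WittVector p (ResidueField O)) O := by
  obtain ⟨π, hπ⟩ := IsDiscreteValuationRing.exists_irreducible O
  let ϖ : Uniformizer O := ⟨π, hπ⟩
  have h1 : (p : O) ≠ 0 := Nat.cast_ne_zero.mpr (Fact.out : p.Prime).ne_zero
  obtain ⟨e, he⟩ := IsDiscreteValuationRing.associated_pow_irreducible h1 hπ
  let f : (Fin e → WittVector p (ResidueField O)) →ₗ[WittVector p (ResidueField O)] O :=
    Fintype.linearCombination _ fun i : Fin e => π ^ (i : ℕ)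
  have hsmul : ∀ (a : WittVector p (ResidueField O)) (y : O), a • y = wittLift p O a * y :=
    fun a y => Algebra.smul_def a y
  have hf : ∀ y, f y = ∑ i : Fin e, wittLift p O (y i) * π ^ (i : ℕ) := fun y => by
    simp only [f, Fintype.linearCombination_apply, hsmul]
  have : IsPrecomplete (Ideal.span {(p : WittVector p (ResidueField O))})
      (Fin e → WittVector p (ResidueField O)) := isPrecomplete_pi _
  have : IsHausdorff (Ideal.span {(p : WittVector p (ResidueField O))}) O := by
    refine ⟨fun x hx => eq_of_forall_pow_dvd ϖ fun n => ?_⟩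
    obtain ⟨z, hz⟩ := (smodEq_span_pow_iff _ n _ _).mp (hx n)
    rw [hsmul, map_pow, map_natCast] at hz
    exact (pow_dvd_pow_of_dvd (dvd_prime ϖ p) n).trans ⟨z, hz.symm⟩
  refine Module.Finite.of_surjective f
    (surjective_of_mkQ_comp_surjective (I := Ideal.span {(p : WittVector p (ResidueField O))}) ?_)
  intro x
  obtain ⟨x, rfl⟩ := Submodule.mkQ_surjective _ x
  obtain ⟨y, hy⟩ := exists_digits p O ϖ x e
  obtain ⟨z, hz⟩ := he.dvd.trans hy
  refine ⟨fun i => y i, ?_⟩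
  have := (smodEq_span_pow_iff (p : WittVector p (ResidueField O)) 1 x (f fun i => y i)).mpr
    ⟨z, by rw [hsmul, pow_one, map_natCast, ← hz, hf, Fin.sum_univ_eq_sum_range
      (fun i => wittLift p O (y i) * π ^ i)]⟩
  rw [pow_one] at this
  exact this.symm

theorem free_wittAlgebra [CharZero O] : Module.Free (WittVector p (ResidueField O)) O := by
  have := finite_wittAlgebra p O
  have : FaithfulSMul (WittVector p (ResidueField O)) O :=
    (faithfulSMul_iff_algebraMap_injective _ _).mpr (wittLift_injective p O)
  infer_instance

end WittLift

/-! ### The Greenberg algebra, the ramified Witt vectors and the comparison, as functors -/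

section Comparison

variable (p : ℕ) [Fact p.Prime] {O : Type u} [CommRing O] [IsDomain O]
  [IsDiscreteValuationRing O] [Finite (ResidueField O)] [IsAdicComplete (maximalIdeal O) O]
  [CharP (ResidueField O) p] (ϖ : Uniformizer O)

attribute [local instance] wittAlgebra

/-- `W(A)` as an algebra over `W(k)`, for a `k`-algebra `A`. -/
@[reducible]
def wittMapAlgebra (k : Type u) (A : Type v) [CommRing k] [CommRing A] [Algebra k A] :
    Algebra (WittVector p k) (WittVector p A) :=
  (WittVector.map (algebraMap k A)).toAlgebra

attribute [local instance] wittMapAlgebra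

/-- The homomorphism `W(A) → W(B)` induced by a homomorphism of `k`-algebras `A → B`. -/
def wittMapAlgHom {k : Type u} {A B : Type v} [CommRing k] [CommRing A] [CommRing B]
    [Algebra k A] [Algebra k B] (f : A →ₐ[k] B) :
    WittVector p A →ₐ[WittVector p k] WittVector p B :=
  { WittVector.map (f : A →+* B) with
    commutes' := fun x => by
      refine WittVector.ext fun n => ?_
      change f (algebraMap k A (x.coeff n)) = algebraMap k B (x.coeff n)
      exact f.commutes _ }

/-- A `k`-algebra seen as an `O`-algebra. -/
@[reducible]
def residueAlgebra (A : Type v) [CommRing A] [Algebra (ResidueField O) A] : Algebra O A :=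
  Algebra.compHom A (residue O)

variable (O) in
/-- Restriction of scalars from `k`-algebras to `O`-algebras. -/
def residueRestrict : CommAlgCat.{u} (ResidueField O) ⥤ CommAlgCat.{u} O where
  obj A := letI := residueAlgebra (O := O) A; CommAlgCat.of O A
  map {A B} f :=
    letI := residueAlgebra (O := O) A
    letI := residueAlgebra (O := O) B
    CommAlgCat.ofHom (X := A) (Y := B)
      { (f.hom : A →+* B) with commutes' := fun c => f.hom.commutes (residue O c) }

variable (O) in
/-- The functor `A ↦ W(A) ⊗_{W(k)} O` from `k`-algebras to `O`-algebras. -/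
def greenbergFunctor : CommAlgCat.{u} (ResidueField O) ⥤ CommAlgCat.{u} O where
  obj A := CommAlgCat.of O (O ⊗[WittVector p (ResidueField O)] WittVector p A)
  map f := CommAlgCat.ofHom
    (Algebra.TensorProduct.map (AlgHom.id O O) (wittMapAlgHom p f.hom))
  map_id A := by
    rw [show wittMapAlgHom p (CommAlgCat.Hom.hom (𝟙 A)) = AlgHom.id _ _ from rfl,
      Algebra.TensorProduct.map_id]
    rfl
  map_comp f g := by
    rw [← CommAlgCat.ofHom_comp, ← Algebra.TensorProduct.map_comp]
    rfl

/-- The functor `B ↦ W_O(B)` from `O`-algebras to `O`-algebras. -/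
def rwittFunctor : CommAlgCat.{u} O ⥤ CommAlgCat.{u} O where
  obj B := CommAlgCat.of O (RWitt ϖ B)
  map f := CommAlgCat.ofHom
    { RWitt.map f.hom with commutes' := fun c => RWitt.map_algebraMap f.hom c }

/-- `W_O(A)` as an algebra over `W(k)`. -/
@[reducible]
def rwittAlgebra (A : Type v) [CommRing A] [Algebra O A] :
    Algebra (WittVector p (ResidueField O)) (RWitt ϖ A) :=
  Algebra.compHom (RWitt ϖ A) (wittLift p O)

attribute [local instance] rwittAlgebra

instance rwittTower (A : Type v) [CommRing A] [Algebra O A] :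
    IsScalarTower (WittVector p (ResidueField O)) O (RWitt ϖ A) :=
  IsScalarTower.of_algebraMap_eq fun _ => rfl

/-- The Drinfeld map `u : W(A) → W_O(A)` of a `k`-algebra `A` is a homomorphism of
`W(k)`-algebras. -/
def drinfeldAlgHom (A : Type v) [CommRing A] [Algebra (ResidueField O) A] [Algebra O A]
    [IsScalarTower O (ResidueField O) A] :
    WittVector p A →ₐ[WittVector p (ResidueField O)] RWitt ϖ A :=
  { RWitt.drinfeld p ϖ A with
    commutes' := fun x => by
      have h := RWitt.map_drinfeld p (ϖ := ϖ) (IsScalarTower.toAlgHom O (ResidueField O) A) x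
      rw [← algebraMap_wittLift, RWitt.map_algebraMap] at h
      exact h.symm }

/-- The comparison homomorphism `r_A = u ⊗ id : W(A) ⊗_{W(k)} O → W_O(A)` of `O`-algebras, for
a `k`-algebra `A`. -/
def comparisonAlgHom (A : Type v) [CommRing A] [Algebra (ResidueField O) A] [Algebra O A]
    [IsScalarTower O (ResidueField O) A] :
    O ⊗[WittVector p (ResidueField O)] WittVector p A →ₐ[O] RWitt ϖ A :=
  Algebra.TensorProduct.lift (Algebra.ofId O (RWitt ϖ A)) (drinfeldAlgHom p ϖ A)
    fun _ _ => Commute.all _ _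

theorem comparisonAlgHom_tmul (A : Type v) [CommRing A] [Algebra (ResidueField O) A]
    [Algebra O A] [IsScalarTower O (ResidueField O) A] (c : O) (x : WittVector p A) :
    comparisonAlgHom p ϖ A (c ⊗ₜ x) = algebraMap O (RWitt ϖ A) c * RWitt.drinfeld p ϖ A x :=
  Algebra.TensorProduct.lift_tmul _ _ _ _ _

theorem comparisonAlgHom_map {A B : Type v} [CommRing A] [Algebra (ResidueField O) A]
    [Algebra O A] [IsScalarTower O (ResidueField O) A] [CommRing B]
    [Algebra (ResidueField O) B] [Algebra O B] [IsScalarTower O (ResidueField O) B]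
    (f : A →ₐ[ResidueField O] B) (z : O ⊗[WittVector p (ResidueField O)] WittVector p A) :
    comparisonAlgHom p ϖ B (Algebra.TensorProduct.map (AlgHom.id O O) (wittMapAlgHom p f) z) =
      RWitt.map (f.restrictScalars O) (comparisonAlgHom p ϖ A z) := by
  induction z using TensorProduct.induction_on with
  | zero => simp only [map_zero]
  | add x y hx hy => simp only [map_add, hx, hy]
  | tmul c x =>
    rw [Algebra.TensorProduct.map_tmul, comparisonAlgHom_tmul, comparisonAlgHom_tmul, map_mul,
      RWitt.map_algebraMap, RWitt.map_drinfeld]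
    rfl

/-- The comparison homomorphisms `r_A`, as a natural transformation. -/
def comparison : greenbergFunctor p O ⟶ residueRestrict O ⋙ rwittFunctor ϖ where
  app A :=
    letI := residueAlgebra (O := O) A
    haveI : IsScalarTower O (ResidueField O) A := IsScalarTower.of_algebraMap_eq fun _ => rfl
    CommAlgCat.ofHom (comparisonAlgHom p ϖ A)
  naturality A B f := by
    let := residueAlgebra (O := O) A
    let := residueAlgebra (O := O) B
    have : IsScalarTower O (ResidueField O) A := IsScalarTower.of_algebraMap_eq fun _ => rfl
    have : IsScalarTower O (ResidueField O) B := IsScalarTower.of_algebraMap_eq fun _ => rfl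
    ext z
    exact comparisonAlgHom_map p ϖ f.hom z

/-! ### The representing schemes -/

/-- The restriction of `W_O` to `k`-algebras is represented by the polynomial ring
`k[X₀, X₁, ...]`, that is, by the special fiber of the scheme of ramified Witt vectors. -/
def rwittCorepresentableBy :
    ((residueRestrict O ⋙ rwittFunctor ϖ) ⋙ forget (CommAlgCat.{u} O)).CorepresentableBy
      (CommAlgCat.of (ResidueField O) (MvPolynomial ℕ (ResidueField O))) where
  homEquiv {A} :=
    { toFun := fun f => (⟨fun n => f.hom (MvPolynomial.X n)⟩ : RWitt ϖ A)
      invFun := fun x => CommAlgCat.ofHom (MvPolynomial.aeval (RWitt.coeff (B := A) x))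
      left_inv := fun f => by ext n; simp
      right_inv := fun x => RWitt.ext (funext fun n => by simp) }
  homEquiv_comp f g := rfl

variable [CharZero O]

variable (O) in
/-- The rank `e` of `O` over `W(k)`, which is the absolute ramification index of `O`. -/
def absRamification : ℕ := Module.finrank (WittVector p (ResidueField O)) O

variable (O) in
/-- A basis of `O` over `W(k)`. -/
def greenbergBasis : Module.Basis (Fin (absRamification p O)) (WittVector p (ResidueField O)) O :=
  haveI := finite_wittAlgebra p O
  haveI := free_wittAlgebra p O
  Module.finBasis (WittVector p (ResidueField O)) O

variable (O) in
/-- The coordinate ring of the Greenberg algebra: as a scheme, the Greenberg algebra is the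
product of `e` copies of the scheme of Witt vectors over `k`. -/
abbrev greenbergRing : Type u :=
  MvPolynomial (Fin (absRamification p O) × ℕ) (ResidueField O)

variable (O) in
/-- The coordinates of an element of `W(A) ⊗_{W(k)} O` in the chosen basis. -/
def greenbergCoord (A : Type v) [CommRing A] [Algebra (ResidueField O) A] :
    (Fin (absRamification p O) → WittVector p A) ≃
      O ⊗[WittVector p (ResidueField O)] WittVector p A :=
  Finsupp.equivFunOnFinite.symm.trans
    (TensorProduct.equivFinsuppOfBasisLeft (N := WittVector p A)
      (greenbergBasis p O)).symm.toEquiv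

theorem greenbergCoord_apply (A : Type v) [CommRing A] [Algebra (ResidueField O) A]
    (x : Fin (absRamification p O) → WittVector p A) :
    greenbergCoord p O A x = ∑ i, greenbergBasis p O i ⊗ₜ x i := by
  change (TensorProduct.equivFinsuppOfBasisLeft (greenbergBasis p O)).symm _ = _
  rw [TensorProduct.equivFinsuppOfBasisLeft_symm_apply, Finsupp.sum_fintype _ _ (by simp)]
  rfl

variable (O) in
/-- The points of the Greenberg algebra with values in a `k`-algebra `A` are the elements of
`W(A) ⊗_{W(k)} O`. -/
def greenbergPoints (A : Type v) [CommRing A] [Algebra (ResidueField O) A] :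
    (greenbergRing p O →ₐ[ResidueField O] A) ≃
      O ⊗[WittVector p (ResidueField O)] WittVector p A :=
  Equiv.trans
    { toFun := fun f i => WittVector.mk p fun n => f (MvPolynomial.X (i, n))
      invFun := fun x => MvPolynomial.aeval fun j => (x j.1).coeff j.2
      left_inv := fun f => by ext n; simp
      right_inv := fun x => funext fun i => WittVector.ext fun n => by simp }
    (greenbergCoord p O A)

theorem greenbergPoints_apply (A : Type v) [CommRing A] [Algebra (ResidueField O) A]
    (f : greenbergRing p O →ₐ[ResidueField O] A) :
    greenbergPoints p O A f = ∑ i, greenbergBasis p O i ⊗ₜ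
      (WittVector.mk p fun n => f (MvPolynomial.X (i, n)) : WittVector p A) :=
  greenbergCoord_apply p A _

theorem greenbergPoints_comp {A B : Type v} [CommRing A] [Algebra (ResidueField O) A]
    [CommRing B] [Algebra (ResidueField O) B] (f : A →ₐ[ResidueField O] B)
    (g : greenbergRing p O →ₐ[ResidueField O] A) :
    greenbergPoints p O B (f.comp g) =
      Algebra.TensorProduct.map (AlgHom.id O O) (wittMapAlgHom p f) (greenbergPoints p O A g) := by
  rw [greenbergPoints_apply, greenbergPoints_apply, map_sum]
  refine Finset.sum_congr rfl fun i _ => ?_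
  rw [Algebra.TensorProduct.map_tmul]
  rfl

variable (O) in
/-- The functor `A ↦ W(A) ⊗_{W(k)} O` is represented by the Greenberg algebra. -/
def greenbergCorepresentableBy :
    (greenbergFunctor p O ⋙ forget (CommAlgCat.{u} O)).CorepresentableBy
      (CommAlgCat.of (ResidueField O) (greenbergRing p O)) where
  homEquiv {A} :=
    { toFun := fun f => greenbergPoints p O A f.hom
      invFun := fun x => CommAlgCat.ofHom ((greenbergPoints p O A).symm x)
      left_inv := fun f => congrArg CommAlgCat.ofHom ((greenbergPoints p O A).symm_apply_apply f.hom)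
      right_inv := fun x => (greenbergPoints p O A).apply_symm_apply x }
  homEquiv_comp f g := greenbergPoints_comp p f.hom g.hom

variable (O) in
/-- The Greenberg algebra `ℝ_O`, as a scheme. -/
def greenbergScheme : Scheme.{u} := Spec (CommRingCat.of (greenbergRing p O))

variable (O) in
/-- The special fiber `𝕎_{O,k}` of the scheme of ramified Witt vectors. -/
def rwittSpecialFiber : Scheme.{u} := Spec (CommRingCat.of (MvPolynomial ℕ (ResidueField O)))

/-- The homomorphism of coordinate rings that corresponds to `comparison` under the Yoneda
lemma. -/
def comparisonCoord :
    CommAlgCat.of (ResidueField O) (MvPolynomial ℕ (ResidueField O)) ⟶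
      CommAlgCat.of (ResidueField O) (greenbergRing p O) :=
  (rwittCorepresentableBy ϖ).homEquiv.symm
    ((Functor.whiskerRight (comparison p ϖ) (forget (CommAlgCat.{u} O))).app _
      ((greenbergCorepresentableBy p O).homEquiv (𝟙 _)))

/-- On points, `comparisonCoord` induces the homomorphisms `r_A`. -/
theorem comparisonCoord_points (A : CommAlgCat.{u} (ResidueField O))
    (f : CommAlgCat.of (ResidueField O) (greenbergRing p O) ⟶ A) :
    (rwittCorepresentableBy ϖ).homEquiv (comparisonCoord p ϖ ≫ f) =
      (comparison p ϖ).app A ((greenbergCorepresentableBy p O).homEquiv f) := by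
  rw [(rwittCorepresentableBy ϖ).homEquiv_comp, comparisonCoord, Equiv.apply_symm_apply]
  have h := (greenbergCorepresentableBy p O).homEquiv_comp f (𝟙 _)
  rw [Category.id_comp] at h
  rw [h]
  exact (NatTrans.naturality_apply
    (Functor.whiskerRight (comparison p ϖ) (forget (CommAlgCat.{u} O))) f _).symm

/-- The homomorphism `r^*` on global sections. -/
def comparisonRingHom : CommRingCat.of (MvPolynomial ℕ (ResidueField O)) ⟶
    CommRingCat.of (greenbergRing p O) :=
  CommRingCat.ofHom (comparisonCoord p ϖ).hom.toRingHom

/-- The comparison morphism `r : ℝ_O → 𝕎_{O,k}`. -/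
def comparisonMorphism : greenbergScheme p O ⟶ rwittSpecialFiber O :=
  Spec.map (comparisonRingHom p ϖ)

/-- The kernel of `r`, as the group functor `A ↦ ker r_A` on `k`-algebras. -/
def comparisonKernel : CommAlgCat.{u} (ResidueField O) ⥤ AddCommGrpCat.{u} where
  obj A := AddCommGrpCat.of (RingHom.ker ((comparison p ϖ).app A).hom)
  map {A B} f := AddCommGrpCat.ofHom
    { toFun := fun x => ⟨((greenbergFunctor p O).map f).hom x.1, by
        have h := NatTrans.naturality_apply (comparison p ϖ) f x.1
        have hx : ((comparison p ϖ).app A).hom x.1 = 0 := x.2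
        refine h.trans ?_
        exact (congrArg ((residueRestrict O ⋙ rwittFunctor ϖ).map f).hom hx).trans (map_zero _)⟩
      map_zero' := Subtype.ext (map_zero ((greenbergFunctor p O).map f).hom)
      map_add' := fun x y => Subtype.ext (map_add ((greenbergFunctor p O).map f).hom x.1 y.1) }
  map_id A := by
    ext x
    change ((greenbergFunctor p O).map (𝟙 A)).hom x.1 = x.1
    rw [(greenbergFunctor p O).map_id]
    rfl
  map_comp f g := by
    ext x
    change ((greenbergFunctor p O).map (f ≫ g)).hom x.1 = _
    rw [(greenbergFunctor p O).map_comp]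
    rfl

end Comparison

/-- The scheme `Spec k[X₀, X₁, ...]` is the special fiber of `Spec O[X₀, X₁, ...]`. -/
theorem isPullback_rwittSpecialFiber (O : Type u) [CommRing O] [IsLocalRing O] :
    IsPullback
    (Spec.map (CommRingCat.ofHom (MvPolynomial.map (σ := ℕ) (residue O))))
    (Spec.map (CommRingCat.ofHom
      (algebraMap (ResidueField O) (MvPolynomial ℕ (ResidueField O)))))
    (Spec.map (CommRingCat.ofHom (algebraMap O (MvPolynomial ℕ O))))
    (Spec.map (CommRingCat.ofHom (residue O))) := by
  apply isPullback_SpecMap_of_isPushout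
  let := MvPolynomial.algebraMvPolynomial (σ := ℕ) (R := O) (S := ResidueField O)
  exact CommRingCat.isPushout_of_isPushout O (MvPolynomial ℕ O) (ResidueField O)
    (MvPolynomial ℕ (ResidueField O))

/-! ### Perfection, universal homeomorphisms, pro-infinitesimal groups -/

/-- The inverse system of copies of `Spec S` with the absolute Frobenius as transition maps. -/
def frobeniusTower (p : ℕ) [Fact p.Prime] (S : CommRingCat.{u}) [CharP S p] :
    ℕᵒᵖ ⥤ Scheme.{u} :=
  (Functor.ofSequence (X := fun _ => S)
    fun _ => CommRingCat.ofHom (frobenius S p)).op ⋙ Scheme.Spec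

instance (p : ℕ) [Fact p.Prime] (S : CommRingCat.{u}) [CharP S p] :
    HasLimit (frobeniusTower p S) := by
  unfold frobeniusTower
  infer_instance

/-- The inverse perfection `X^pf` of `X = Spec S`: the limit of the copies of `X` along the
absolute Frobenius. -/
def perfection (p : ℕ) [Fact p.Prime] (S : CommRingCat.{u}) [CharP S p] : Scheme.{u} :=
  limit (frobeniusTower p S)

/-- The morphism induced on the Frobenius towers by `Spec T → Spec S`. -/
def frobeniusTowerMap (p : ℕ) [Fact p.Prime] {S T : CommRingCat.{u}} [CharP S p] [CharP T p]
    (f : S ⟶ T) : frobeniusTower p T ⟶ frobeniusTower p S :=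
  Functor.whiskerRight (NatTrans.op (NatTrans.ofSequence
    (F := Functor.ofSequence (X := fun _ => S) fun _ => CommRingCat.ofHom (frobenius S p))
    (G := Functor.ofSequence (X := fun _ => T) fun _ => CommRingCat.ofHom (frobenius T p))
    (fun _ => f) fun n => by
      rw [Functor.ofSequence_map_homOfLE_succ, Functor.ofSequence_map_homOfLE_succ]
      ext x
      exact map_pow f.hom x p)) Scheme.Spec

/-- The morphism `X^pf → Y^pf` induced on perfections by a morphism `X = Spec T → Y = Spec S`. -/
def perfectionMap (p : ℕ) [Fact p.Prime] {S T : CommRingCat.{u}} [CharP S p] [CharP T p]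
    (f : S ⟶ T) : perfection p T ⟶ perfection p S :=
  limMap (frobeniusTowerMap p f)

/-- A universal homeomorphism: every base change is a homeomorphism. -/
def IsUniversalHomeomorphism : MorphismProperty Scheme.{u} :=
  (topologically @IsHomeomorph).universally

/-- A commutative `k`-group (as a functor on `k`-algebras) is infinitesimal if it is represented
by a finite local `k`-scheme. -/
def IsInfinitesimal {k : Type u} [Field k] (G : CommAlgCat.{u} k ⥤ AddCommGrpCat.{u}) : Prop :=
  ∃ H : CommAlgCat.{u} k, Nonempty ((G ⋙ forget AddCommGrpCat).CorepresentableBy H) ∧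
    Module.Finite k H ∧ IsLocalRing H

/-- A commutative `k`-group is pro-infinitesimal if it is a cofiltered limit of infinitesimal
`k`-groups. -/
def IsProInfinitesimal {k : Type u} [Field k] (G : CommAlgCat.{u} k ⥤ AddCommGrpCat.{u}) : Prop :=
  ∃ (J : Type u) (_ : SmallCategory J) (_ : IsCofiltered J)
    (F : J ⥤ CommAlgCat.{u} k ⥤ AddCommGrpCat.{u}) (c : Cone F),
    Nonempty (IsLimit c) ∧ Nonempty (c.pt ≅ G) ∧ ∀ j, IsInfinitesimal (F.obj j)

end

/-! ### Multiplication by the uniformizer on ramified Witt vectors of `k`-algebras -/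

namespace RamifiedWitt

/-! Everything rests on one fact: r_A is bijective for every perfect k-algebra A. Since π vanishes
in A, multiplication by π on W_O(A) is the shift composed with the q-power map
(`RWitt.uniformizer_mul_coeff`). Hence W_O(A) is π-adically separated, and for perfect A the element
π is a nonzerodivisor with quotient W_O(A)/π = A. On the other side W(A) ⊗ O is finite free over
W(A), hence p-adically separated, and an element whose image under r_A has zero component of index 0
is divisible by π. Successive approximation in powers of π then gives injectivity, and surjectivity
follows from p-adic completeness of W(A) (`comparisonAlgHom_injective`,
`comparisonAlgHom_surjective`).

Both schemes are spectra of polynomial rings over k, hence reduced. Testing on the perfect closures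
of the two coordinate rings turns bijectivity on perfect points into a statement about r^*: it is
injective, and every element of the target has a p^n-th power in its image
(`comparisonCoord_injective_and_exists_pow`).

The three assertions follow from this. Passing to the colimit along Frobenius makes r^* an
isomorphism. The morphism r is integral, surjective and universally injective, hence a universal
homeomorphism. Finally, the kernel is a closed subgroup of a finite power of the Witt vector group,
and the coordinate functions on it are nilpotent (`exists_X_pow_mem_kernelIdeal`). It is the limit
of its scheme-theoretic images in the truncated Witt vector groups, whose coordinate rings are
generated by finitely many nilpotents and so are finite and local
(`WittLocus.isProInfinitesimal_group`). -/

theorem dvd_sub_of_pow_dvd_ghost_sub {B : Type v} [CommRing B] {w : B} (hw : w ∈ nonZeroDivisors B)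
    {q : ℕ} (hq : w ∣ (q : B)) {b c : ℕ → B}
    (h : ∀ n, w ^ (n + 1) ∣ ghost w q b n - ghost w q c n) (n : ℕ) : w ∣ b n - c n := by
  induction n using Nat.strong_induction_on with
  | _ n ih =>
    have h1 := h n
    rw [ghost, ghost, Finset.sum_range_succ, Finset.sum_range_succ, add_sub_add_comm,
      ← Finset.sum_sub_distrib] at h1
    -- The terms of index below n agree modulo w^(n+1) by induction. Only w^n (b n - c n) remains,
    -- and w^n can be cancelled.
    have h2 : w ^ (n + 1) ∣ ∑ i ∈ Finset.range n,
        (w ^ i * b i ^ q ^ (n - i) - w ^ i * c i ^ q ^ (n - i)) := by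
      refine Finset.dvd_sum fun i hi => ?_
      have hi := Finset.mem_range.mp hi
      rw [← mul_sub, show n + 1 = i + (n - i + 1) by omega, pow_add]
      exact mul_dvd_mul_left _ (pow_dvd_pow_sub_pow hq (ih i hi) _)
    obtain ⟨d, hd⟩ := (dvd_add_right h2).mp h1
    rw [Nat.sub_self, pow_zero, pow_one, pow_one, ← mul_sub, pow_succ, mul_assoc] at hd
    exact ⟨d, (mul_cancel_left_mem_nonZeroDivisors (pow_mem hw n)).mp hd⟩

end RamifiedWitt

namespace RWitt

open RamifiedWitt

variable {O : Type u} [CommRing O] [IsDomain O] [IsDiscreteValuationRing O]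
  [Finite (ResidueField O)] {ϖ : Uniformizer O} {B : Type v} [CommRing B] [Algebra O B]

theorem ghostFun_algebraMap (c : O) (n : ℕ) :
    ghostFun (algebraMap O (RWitt ϖ B) c) n = algebraMap O B c := by
  have h := gh_map ϖ (Algebra.ofId O B) (scalar ϖ c).coeff n
  have h2 : gh ϖ (scalar ϖ c).coeff n = c := ghostFun_scalar ϖ c n
  rw [h2] at h
  exact h.symm

theorem ghostFun_zero_index (x : RWitt ϖ B) : ghostFun x 0 = x.coeff 0 := by
  simp [ghostFun, ghost]

variable (ϖ B) in
/-- The component of index `0`, as a ring homomorphism. -/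
def coeffZero : RWitt ϖ B →+* B where
  toFun x := x.coeff 0
  map_zero' := rfl
  map_one' := rfl
  map_add' x y := by simpa only [ghostFun_zero_index] using ghostFun_add x y 0
  map_mul' x y := by simpa only [ghostFun_zero_index] using ghostFun_mul x y 0

theorem coeffZero_apply (x : RWitt ϖ B) : coeffZero ϖ B x = x.coeff 0 := rfl

theorem coeff_zero_algebraMap (c : O) :
    (algebraMap O (RWitt ϖ B) c).coeff 0 = algebraMap O B c := by
  rw [← ghostFun_zero_index, ghostFun_algebraMap]

/-- Multiplication by the uniformizer is the composite of the shift and of the `q`-power map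
modulo the uniformizer. -/
theorem uniformizer_mul_coeff (hB : algebraMap O B ϖ.1 = 0) (x : RWitt ϖ B) (n : ℕ) :
    (algebraMap O (RWitt ϖ B) ϖ.1 * x).coeff n =
      if n = 0 then 0 else x.coeff (n - 1) ^ Nat.card (ResidueField O) := by
  -- The formula holds only modulo π. It is proved as a congruence over a polynomial ring, where π
  -- is a nonzerodivisor and ghost components can be compared, and then specialized to B.
  let P := MvPolynomial B O
  obtain ⟨y, rfl⟩ := exists_mapFun_cover x
  let c : ℕ → P := fun n => if n = 0 then 0 else y.coeff (n - 1) ^ Nat.card (ResidueField O)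
  have hq : Nat.card (ResidueField O) ≠ 0 := Nat.card_pos.ne'
  have key : ∀ n, algebraMap O P ϖ.1 ∣ (algebraMap O (RWitt ϖ P) ϖ.1 * y).coeff n - c n := by
    refine dvd_sub_of_pow_dvd_ghost_sub (algebraMap_uniformizer_mem ϖ B)
      (by simpa [P] using map_dvd (algebraMap O P) (dvd_card ϖ)) fun n => ?_
    have h1 : ghost (algebraMap O P ϖ.1) (Nat.card (ResidueField O))
        (algebraMap O (RWitt ϖ P) ϖ.1 * y).coeff n =
        algebraMap O P ϖ.1 * ghost (algebraMap O P ϖ.1) (Nat.card (ResidueField O)) y.coeff n := by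
      have := ghostFun_mul (algebraMap O (RWitt ϖ P) ϖ.1) y n
      rwa [ghostFun_algebraMap] at this
    -- The ghost component of the shifted sequence is π times that of y without its last term π^n
    -- y_n, so the two sides differ by π^(n+1) y_n.
    have h2 : ghost (algebraMap O P ϖ.1) (Nat.card (ResidueField O)) c n =
        algebraMap O P ϖ.1 * ∑ i ∈ Finset.range n,
          algebraMap O P ϖ.1 ^ i * y.coeff i ^ Nat.card (ResidueField O) ^ (n - i) := by
      rw [ghost, Finset.sum_range_succ', Finset.mul_sum]
      simp only [c, if_pos, zero_pow (pow_ne_zero _ hq), mul_zero, add_zero]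
      refine Finset.sum_congr rfl fun i hi => ?_
      have hi := Finset.mem_range.mp hi
      rw [if_neg (Nat.succ_ne_zero i), Nat.add_sub_cancel, ← pow_mul, ← pow_succ',
        show n - (i + 1) + 1 = n - i by omega]
      ring
    rw [h1, h2, ← mul_sub, ghost, Finset.sum_range_succ, add_sub_cancel_left, pow_succ']
    exact mul_dvd_mul_left _ (dvd_mul_right _ _)
  obtain ⟨d, hd⟩ := key n
  have h3 := congrArg (cover O B) hd
  rw [map_sub, map_mul, AlgHom.commutes, hB, zero_mul, sub_eq_zero] at h3
  have h4 : (algebraMap O (RWitt ϖ B) ϖ.1 * mapFun (cover O B) y).coeff n =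
      cover O B ((algebraMap O (RWitt ϖ P) ϖ.1 * y).coeff n) := by
    rw [← map_algebraMap (cover O B)]
    exact congrArg (fun z => coeff z n) (map_mul (map (cover O B)) _ y).symm
  rw [h4, h3]
  simp only [c]
  split_ifs
  · exact map_zero _
  · exact map_pow _ _ _

theorem coeff_uniformizer_pow_mul (hB : algebraMap O B ϖ.1 = 0) (m : ℕ) (x : RWitt ϖ B) {n : ℕ}
    (hn : n < m) : (algebraMap O (RWitt ϖ B) ϖ.1 ^ m * x).coeff n = 0 := by
  induction m generalizing n with
  | zero => omega
  | succ m ih =>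
    rw [pow_succ', mul_assoc, uniformizer_mul_coeff hB]
    split_ifs with h
    · rfl
    · rw [ih (by omega), zero_pow Nat.card_pos.ne']

/-- `W_O(B)` is separated for the topology defined by the uniformizer. -/
theorem eq_zero_of_forall_dvd (hB : algebraMap O B ϖ.1 = 0) {x : RWitt ϖ B}
    (h : ∀ m, algebraMap O (RWitt ϖ B) ϖ.1 ^ m ∣ x) : x = 0 :=
  RWitt.ext (funext fun n => by
    obtain ⟨y, rfl⟩ := h (n + 1)
    exact coeff_uniformizer_pow_mul hB (n + 1) y n.lt_succ_self)

/-! ### Ramified Witt vectors of perfect algebras: the uniformizer is regular and the residue ring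
is B. -/

section Perfect

variable (p : ℕ) [Fact p.Prime] [CharP (ResidueField O) p] [CharP B p] [PerfectRing B p]

include p in
theorem bijective_pow_card :
    Function.Bijective fun b : B => b ^ Nat.card (ResidueField O) := by
  rw [(card_pos_exponent (O := O) p).1]
  exact bijective_iterateFrobenius B p _

include p in
theorem eq_zero_of_uniformizer_mul (hB : algebraMap O B ϖ.1 = 0) {x : RWitt ϖ B}
    (h : algebraMap O (RWitt ϖ B) ϖ.1 * x = 0) : x = 0 := by
  refine RWitt.ext (funext fun n => ?_)
  have h1 := congrArg (fun z => coeff z (n + 1)) h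
  simp only [uniformizer_mul_coeff hB, Nat.succ_ne_zero, if_false, Nat.add_sub_cancel] at h1
  exact (bijective_pow_card (O := O) (B := B) p).1
    (h1.trans (zero_pow (M₀ := B) Nat.card_pos.ne').symm)

-- Multiplication by π can be undone on such x by taking q-th roots of the components and shifting
-- them down.
include p in
theorem uniformizer_dvd_of_coeff_zero (hB : algebraMap O B ϖ.1 = 0) {x : RWitt ϖ B}
    (h : x.coeff 0 = 0) : algebraMap O (RWitt ϖ B) ϖ.1 ∣ x := by
  choose y hy using fun n => (bijective_pow_card (O := O) (B := B) p).2 (x.coeff (n + 1))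
  refine ⟨⟨y⟩, RWitt.ext (funext fun n => ?_)⟩
  rw [uniformizer_mul_coeff hB]
  cases n with
  | zero => exact h
  | succ n => exact (hy n).symm

/-- A π-adic expansion with digits in the image of u. The Teichmüller lift of the component of index
0 is a valid digit because u preserves that component. For j equal to the valuation of p, this gives
generators of W_O(B) modulo p over W(B). -/
theorem exists_drinfeld_digits (hB : algebraMap O B ϖ.1 = 0) (x : RWitt ϖ B) (j : ℕ) :
    ∃ y : ℕ → WittVector p B, algebraMap O (RWitt ϖ B) ϖ.1 ^ j ∣
      x - ∑ i ∈ Finset.range j, drinfeld p ϖ B (y i) * algebraMap O (RWitt ϖ B) ϖ.1 ^ i := by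
  induction j with
  | zero => simp
  | succ j ih =>
    obtain ⟨y, z, hz⟩ := ih
    let t := WittVector.teichmuller p (z.coeff 0)
    have ht : algebraMap O (RWitt ϖ B) ϖ.1 ∣ z - drinfeld p ϖ B t := by
      refine uniformizer_dvd_of_coeff_zero p hB ?_
      rw [← coeffZero_apply, map_sub, coeffZero_apply, coeffZero_apply, drinfeld_coeff_zero,
        WittVector.teichmuller_coeff_zero, sub_self]
    refine ⟨Function.update y j t, ?_⟩
    rw [Finset.sum_range_succ, Function.update_self, Finset.sum_congr rfl fun i hi => by
      rw [Function.update_of_ne (Finset.mem_range.mp hi).ne], ← sub_sub, hz, mul_comm, ← sub_mul,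
      mul_comm, pow_succ]
    exact mul_dvd_mul_left _ ht

end Perfect

end RWitt

/-! ### The comparison homomorphism for perfect algebras -/

section Perfect

open RamifiedWitt

variable (p : ℕ) [Fact p.Prime] {O : Type u} [CommRing O] [IsDomain O]
  [IsDiscreteValuationRing O] [Finite (ResidueField O)] [IsAdicComplete (maximalIdeal O) O]
  [CharP (ResidueField O) p] (ϖ : Uniformizer O)

attribute [local instance] wittAlgebra wittMapAlgebra rwittAlgebra

variable (A : Type v) [CommRing A] [Algebra (ResidueField O) A] [Algebra O A]
    [IsScalarTower O (ResidueField O) A]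

theorem algebraMap_uniformizer_eq_zero : algebraMap O A ϖ.1 = 0 := by
  rw [IsScalarTower.algebraMap_apply O (ResidueField O) A]
  have : algebraMap O (ResidueField O) ϖ.1 = 0 := (uniformizer_dvd_iff ϖ ϖ.1).mp dvd_rfl
  rw [this, map_zero]

variable [CharZero O] [CharP A p] [PerfectRing A p]

/-- View W_O(A) as a W(A)-module through u. With e the valuation of p, the elements 1, π, ...,
π^(e-1) generate it modulo p. Completeness of W(A)^e and separatedness of W_O(A) for the p-adic
topology lift this to actual generation, and all these generators come from O. -/
theorem comparisonAlgHom_surjective : Function.Surjective (comparisonAlgHom p ϖ A) := by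
  have hA := algebraMap_uniformizer_eq_zero ϖ A
  let _ : Algebra (WittVector p A) (RWitt ϖ A) := (RWitt.drinfeld p ϖ A).toAlgebra
  have h1 : (p : O) ≠ 0 := Nat.cast_ne_zero.mpr (Fact.out : p.Prime).ne_zero
  obtain ⟨e, he⟩ := IsDiscreteValuationRing.associated_pow_irreducible h1 ϖ.2
  let f : (Fin e → WittVector p A) →ₗ[WittVector p A] RWitt ϖ A :=
    Fintype.linearCombination _ fun i : Fin e => algebraMap O (RWitt ϖ A) ϖ.1 ^ (i : ℕ)
  have hsmul : ∀ (a : WittVector p A) (y : RWitt ϖ A), a • y = RWitt.drinfeld p ϖ A a * y :=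
    fun a y => Algebra.smul_def a y
  have hf : ∀ y, f y = ∑ i : Fin e,
      RWitt.drinfeld p ϖ A (y i) * algebraMap O (RWitt ϖ A) ϖ.1 ^ (i : ℕ) := fun y => by
    simp only [f, Fintype.linearCombination_apply, hsmul]
  have : IsPrecomplete (Ideal.span {(p : WittVector p A)}) (Fin e → WittVector p A) :=
    isPrecomplete_pi _
  have hp : algebraMap O (RWitt ϖ A) ϖ.1 ∣ (p : RWitt ϖ A) := by
    simpa using map_dvd (algebraMap O (RWitt ϖ A)) (dvd_prime ϖ p)
  have : IsHausdorff (Ideal.span {(p : WittVector p A)}) (RWitt ϖ A) := by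
    refine ⟨fun x hx => RWitt.eq_zero_of_forall_dvd hA fun n => ?_⟩
    obtain ⟨z, hz⟩ := (smodEq_span_pow_iff _ n _ _).mp (hx n)
    rw [hsmul, map_pow, map_natCast, sub_zero] at hz
    exact (pow_dvd_pow_of_dvd hp n).trans ⟨z, hz.symm⟩
  have hsurj : Function.Surjective f := by
    refine surjective_of_mkQ_comp_surjective (I := Ideal.span {(p : WittVector p A)}) ?_
    intro x
    obtain ⟨x, rfl⟩ := Submodule.mkQ_surjective _ x
    obtain ⟨y, hy⟩ := RWitt.exists_drinfeld_digits p hA x e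
    -- Since p and π^e are associated in O, an expansion with e digits is exactly an approximation
    -- modulo p.
    have hpe : (p : RWitt ϖ A) ∣ algebraMap O (RWitt ϖ A) ϖ.1 ^ e := by
      simpa using map_dvd (algebraMap O (RWitt ϖ A)) he.dvd
    obtain ⟨z, hz⟩ := hpe.trans hy
    refine ⟨fun i => y i, ?_⟩
    have := (smodEq_span_pow_iff (p : WittVector p A) 1 x (f fun i => y i)).mpr
      ⟨z, by rw [hsmul, pow_one, map_natCast, ← hz, hf, Fin.sum_univ_eq_sum_range
        (fun i => RWitt.drinfeld p ϖ A (y i) * algebraMap O (RWitt ϖ A) ϖ.1 ^ i)]⟩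
    rw [pow_one] at this
    exact this.symm
  intro x
  obtain ⟨y, rfl⟩ := hsurj x
  refine ⟨∑ i : Fin e, (ϖ.1 ^ (i : ℕ)) ⊗ₜ y i, ?_⟩
  rw [map_sum, hf]
  exact Finset.sum_congr rfl fun i _ => by rw [comparisonAlgHom_tmul, map_pow, mul_comm]

omit [IsScalarTower O (ResidueField O) A] [Algebra O A] [CharP A p] [PerfectRing A p] in
theorem greenbergCoord_natCast_mul (m : ℕ) (x : Fin (absRamification p O) → WittVector p A) :
    greenbergCoord p O A (fun i => m * x i) = m * greenbergCoord p O A x := by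
  rw [greenbergCoord_apply, greenbergCoord_apply, Finset.mul_sum]
  refine Finset.sum_congr rfl fun i _ => ?_
  rw [← nsmul_eq_mul, ← nsmul_eq_mul, TensorProduct.tmul_smul]

-- Freeness of O over W(k) reduces the claim to Witt vectors over A, where the components of index
-- at most n of a multiple of p^(n+1) vanish because A has characteristic p.
omit [IsScalarTower O (ResidueField O) A] [Algebra O A] in
theorem eq_zero_of_forall_pow_dvd_greenberg
    {z : O ⊗[WittVector p (ResidueField O)] WittVector p A}
    (h : ∀ n, (p : O ⊗[WittVector p (ResidueField O)] WittVector p A) ^ n ∣ z) : z = 0 := by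
  obtain ⟨x, rfl⟩ := (greenbergCoord p O A).surjective z
  have hx : x = fun _ => 0 := by
    funext i
    refine WittVector.ext fun n => ?_
    obtain ⟨y, hy⟩ := h (n + 1)
    obtain ⟨y, rfl⟩ := (greenbergCoord p O A).surjective y
    rw [← Nat.cast_pow, ← greenbergCoord_natCast_mul] at hy
    rw [congrFun ((greenbergCoord p O A).injective hy) i, Nat.cast_pow, mul_comm,
      WittVector.mul_pow_charP_coeff_zero _ n.lt_succ_self, WittVector.zero_coeff]
  rw [hx, greenbergCoord_apply]
  simp

-- Since W(k) and O have the same residue field, every tensor is congruent to some 1 ⊗ x modulo π.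
-- The component of index 0 of its image is then x_0. If x_0 = 0, perfectness of A gives p ∣ x, and
-- π divides p.
omit [CharZero O] in
theorem uniformizer_dvd_of_comparison_coeff_zero
    {z : O ⊗[WittVector p (ResidueField O)] WittVector p A}
    (h : (comparisonAlgHom p ϖ A z).coeff 0 = 0) : algebraMap O _ ϖ.1 ∣ z := by
  have h1 : ∀ z : O ⊗[WittVector p (ResidueField O)] WittVector p A,
      ∃ x : WittVector p A, algebraMap O _ ϖ.1 ∣ z - 1 ⊗ₜ x := by
    intro z
    induction z using TensorProduct.induction_on with
    | zero => exact ⟨0, by simp⟩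
    | add a b ha hb =>
      obtain ⟨x, hx⟩ := ha
      obtain ⟨y, hy⟩ := hb
      refine ⟨x + y, ?_⟩
      rw [TensorProduct.tmul_add, add_sub_add_comm]
      exact dvd_add hx hy
    | tmul c x =>
      -- The scalar c is congruent modulo π to the image of this t in W(k), and t can be moved
      -- across the tensor sign.
      let t := WittVector.teichmuller p (residue O c)
      obtain ⟨d, hd⟩ : ϖ.1 ∣ c - wittLift p O t := by
        rw [uniformizer_dvd_sub_iff, residue_wittLift, WittVector.teichmuller_coeff_zero]
      refine ⟨t • x, d ⊗ₜ x, ?_⟩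
      rw [TensorProduct.tmul_smul, TensorProduct.smul_tmul', ← TensorProduct.sub_tmul,
        Algebra.TensorProduct.algebraMap_apply, Algebra.TensorProduct.tmul_mul_tmul, one_mul,
        Algebra.algebraMap_self_apply, ← hd, Algebra.smul_def, mul_one]
      rfl
  obtain ⟨x, y, hy⟩ := h1 z
  have hz : z = algebraMap O _ ϖ.1 * y + 1 ⊗ₜ x := by rw [← hy, sub_add_cancel]
  rw [hz, map_add, map_mul, AlgHom.commutes, comparisonAlgHom_tmul, map_one, one_mul,
    ← RWitt.coeffZero_apply, map_add, map_mul, RWitt.coeffZero_apply, RWitt.coeffZero_apply,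
    RWitt.coeffZero_apply, RWitt.coeff_zero_algebraMap, algebraMap_uniformizer_eq_zero, zero_mul,
    zero_add, RWitt.drinfeld_coeff_zero, ← WittVector.mem_span_p_iff_coeff_zero_eq_zero,
    Ideal.mem_span_singleton] at h
  obtain ⟨w, rfl⟩ := h
  rw [hz]
  refine dvd_add (dvd_mul_right _ _) ?_
  rw [← nsmul_eq_mul, TensorProduct.tmul_smul, nsmul_eq_mul]
  refine Dvd.dvd.mul_right ?_ _
  simpa using map_dvd (algebraMap O (O ⊗[WittVector p (ResidueField O)] WittVector p A))
    (dvd_prime ϖ p)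

/-- An element of the kernel is divisible by π, and the quotient is again in the kernel because π is
regular on W_O(A). Iterating, the element is divisible by every power of π, hence by every power of
p. -/
theorem comparisonAlgHom_injective : Function.Injective (comparisonAlgHom p ϖ A) := by
  have hA := algebraMap_uniformizer_eq_zero ϖ A
  rw [injective_iff_map_eq_zero]
  intro z hz
  have key : ∀ n, ∃ y, z = algebraMap O _ ϖ.1 ^ n * y ∧ comparisonAlgHom p ϖ A y = 0 := by
    intro n
    induction n with
    | zero => exact ⟨z, by simp, hz⟩
    | succ n ih =>
      obtain ⟨y, hy, hy0⟩ := ih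
      obtain ⟨w, rfl⟩ := uniformizer_dvd_of_comparison_coeff_zero p ϖ A (z := y)
        (by rw [hy0]; rfl)
      refine ⟨w, by rw [hy, pow_succ, mul_assoc], RWitt.eq_zero_of_uniformizer_mul p hA ?_⟩
      rw [← hy0, map_mul, AlgHom.commutes]
  have h1 : (p : O) ≠ 0 := Nat.cast_ne_zero.mpr (Fact.out : p.Prime).ne_zero
  obtain ⟨e, he⟩ := IsDiscreteValuationRing.associated_pow_irreducible h1 ϖ.2
  refine eq_zero_of_forall_pow_dvd_greenberg p A fun n => ?_
  -- The exponent e * n is chosen so that p^n divides π^(e * n).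
  obtain ⟨y, hy, -⟩ := key (e * n)
  refine Dvd.dvd.trans ?_ ⟨y, hy⟩
  rw [pow_mul]
  refine pow_dvd_pow_of_dvd ?_ n
  simpa using map_dvd (algebraMap O (O ⊗[WittVector p (ResidueField O)] WittVector p A)) he.dvd

end Perfect

/-! ### Homomorphisms inducing bijections on points with values in perfect algebras -/

section PerfectPoints

theorem PerfectClosure.of_injective (p : ℕ) [Fact p.Prime] (S : Type u) [CommRing S] [CharP S p]
    [_root_.IsReduced S] : Function.Injective (PerfectClosure.of S p) := fun x y h => by
  rw [PerfectClosure.of_apply, PerfectClosure.of_apply, PerfectClosure.eq_iff] at h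
  exact h

/-- If a homomorphism of reduced algebras induces bijections on points with values in perfect
algebras, then it is injective and its cokernel is killed by powers of the Frobenius. -/
theorem injective_and_exists_pow_mem_range_of_bijective_points (p : ℕ) [Fact p.Prime]
    {k S T : Type u} [CommRing k] [CommRing S] [CommRing T] [Algebra k S] [Algebra k T]
    [CharP S p] [CharP T p]
    [_root_.IsReduced S] [_root_.IsReduced T] (φ : S →ₐ[k] T)
    (h : ∀ (A : Type u) [CommRing A] [Algebra k A] [CharP A p] [PerfectRing A p],
      Function.Bijective fun f : T →ₐ[k] A => f.comp φ) :
    Function.Injective φ ∧ ∀ t : T, ∃ n, ∃ s : S, φ s = t ^ p ^ n := by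
  let _ : Algebra k (PerfectClosure S p) :=
    ((PerfectClosure.of S p).comp (algebraMap k S)).toAlgebra
  let _ : Algebra k (PerfectClosure T p) :=
    ((PerfectClosure.of T p).comp (algebraMap k T)).toAlgebra
  let ιS : S →ₐ[k] PerfectClosure S p := { PerfectClosure.of S p with commutes' := fun _ => rfl }
  let ιT : T →ₐ[k] PerfectClosure T p := { PerfectClosure.of T p with commutes' := fun _ => rfl }
  -- The canonical map from S to its perfect closure extends along φ to a map ψ on T. As S is
  -- reduced the canonical map is injective, and therefore so is φ.
  obtain ⟨ψ, hψ⟩ := (h (PerfectClosure S p)).2 ιS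
  have hψ' : ∀ s, ψ (φ s) = PerfectClosure.of S p s := fun s => DFunLike.congr_fun hψ s
  refine ⟨fun x y hxy => PerfectClosure.of_injective p S ?_, fun t => ?_⟩
  · rw [← hψ', ← hψ', hxy]
  let Φ₀ := PerfectClosure.lift S p (PerfectClosure T p) ((PerfectClosure.of T p).comp φ)
  have hΦ₀ : ∀ s, Φ₀ (PerfectClosure.of S p s) = PerfectClosure.of T p (φ s) := fun s =>
    RingHom.congr_fun ((PerfectClosure.lift S p (PerfectClosure T p)).symm_apply_apply
      ((PerfectClosure.of T p).comp φ)) s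
  let Φ : PerfectClosure S p →ₐ[k] PerfectClosure T p := { Φ₀ with
    commutes' := fun c => (hΦ₀ _).trans (congrArg _ (φ.commutes c)) }
  -- Here Φ is the map induced by φ on perfect closures. Both sides agree after composition with φ,
  -- so uniqueness of extensions identifies them.
  have hΦ : Φ.comp ψ = ιT := (h (PerfectClosure T p)).1 (AlgHom.ext fun s =>
    (congrArg Φ₀ (hψ' s)).trans (hΦ₀ s))
  -- The element ψ(t) is the p^n-th root of some s in S. Applying Φ to ψ(t)^(p^n) = s gives φ(s) =
  -- t^(p^n) in the perfect closure of T, hence in T.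
  obtain ⟨⟨n, s⟩, hs⟩ := PerfectClosure.mk_surjective S p (ψ t)
  refine ⟨n, s, PerfectClosure.of_injective p T ?_⟩
  rw [← hΦ₀, ← PerfectClosure.iterate_frobenius_mk, hs, ← coe_iterateFrobenius,
    iterateFrobenius_def, map_pow, map_pow]
  exact congrArg (· ^ p ^ n) (DFunLike.congr_fun hΦ t)

end PerfectPoints

/-! ### The comparison homomorphism on coordinate rings -/

section Coord

open RamifiedWitt

variable (p : ℕ) [Fact p.Prime] {O : Type u} [CommRing O] [IsDomain O]
  [IsDiscreteValuationRing O] [Finite (ResidueField O)] [IsAdicComplete (maximalIdeal O) O]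
  [CharP (ResidueField O) p] (ϖ : Uniformizer O) [CharZero O]

/-- Under the two representability bijections, composition with r^* becomes r_A, so this is the
bijectivity of r_A for perfect A. -/
theorem bijective_comp_comparisonCoord (A : Type u) [CommRing A] [Algebra (ResidueField O) A]
    [CharP A p] [PerfectRing A p] :
    Function.Bijective fun f : greenbergRing p O →ₐ[ResidueField O] A =>
      f.comp (comparisonCoord p ϖ).hom := by
  let _ := residueAlgebra (O := O) A
  have : IsScalarTower O (ResidueField O) A := IsScalarTower.of_algebraMap_eq fun _ => rfl
  have hb : Function.Bijective (comparisonAlgHom p ϖ A) :=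
    ⟨comparisonAlgHom_injective p ϖ A, comparisonAlgHom_surjective p ϖ A⟩
  let B := CommAlgCat.of (ResidueField O) A
  have h : ∀ f : greenbergRing p O →ₐ[ResidueField O] A,
      (rwittCorepresentableBy ϖ).homEquiv
        (CommAlgCat.ofHom (f.comp (comparisonCoord p ϖ).hom) : _ ⟶ B) =
      comparisonAlgHom p ϖ A (greenbergPoints p O A f) := fun f =>
    comparisonCoord_points p ϖ B (CommAlgCat.ofHom f)
  constructor
  · intro f g hfg
    apply (greenbergPoints p O A).injective
    apply hb.1
    rw [← h f, ← h g]
    exact congrArg (fun z => (rwittCorepresentableBy ϖ).homEquiv (CommAlgCat.ofHom z : _ ⟶ B)) hfg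
  · intro g
    obtain ⟨z, hz⟩ := hb.2 ((rwittCorepresentableBy ϖ).homEquiv (CommAlgCat.ofHom g : _ ⟶ B))
    refine ⟨(greenbergPoints p O A).symm z, ?_⟩
    have h2 := h ((greenbergPoints p O A).symm z)
    rw [Equiv.apply_symm_apply, hz] at h2
    exact congrArg CommAlgCat.Hom.hom ((rwittCorepresentableBy ϖ).homEquiv.injective h2)

/-- The only information on r used for all three assertions. The perfect-point criterion applies
because polynomial rings over the field k are reduced. -/
theorem comparisonCoord_injective_and_exists_pow :
    Function.Injective (comparisonCoord p ϖ).hom ∧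
      ∀ t : greenbergRing p O, ∃ n, ∃ s, (comparisonCoord p ϖ).hom s = t ^ p ^ n :=
  injective_and_exists_pow_mem_range_of_bijective_points p (k := ResidueField O)
    (S := MvPolynomial ℕ (ResidueField O)) (comparisonCoord p ϖ).hom
    fun A => bijective_comp_comparisonCoord p ϖ A

end Coord

/-! ### Perfections and universal homeomorphisms -/

section FIso

theorem ofSequence_map_frobenius (p : ℕ) [Fact p.Prime] (S : CommRingCat.{u}) [CharP S p]
    {i j : ℕ} (hij : i ≤ j) (s : S) :
    ((Functor.ofSequence (X := fun _ => S) fun _ => CommRingCat.ofHom (frobenius S p)).map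
      (homOfLE hij)).hom s = s ^ p ^ (j - i) := by
  induction j, hij using Nat.le_induction with
  | base =>
    rw [Nat.sub_self, pow_zero, pow_one]
    exact ConcreteCategory.congr_hom (CategoryTheory.Functor.map_id
      (Functor.ofSequence (X := fun _ => S) fun _ => CommRingCat.ofHom (frobenius S p)) i) s
  | succ j hij ih =>
    have h1 := ConcreteCategory.congr_hom ((Functor.ofSequence (X := fun _ => S)
      fun _ => CommRingCat.ofHom (frobenius S p)).map_comp (homOfLE hij) (homOfLE j.le_succ)) s
    have h2 := ConcreteCategory.congr_hom (Functor.ofSequence_map_homOfLE_succ (X := fun _ => S)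
      (fun _ => CommRingCat.ofHom (frobenius S p)) j) (s ^ p ^ (j - i))
    have h3 : ∀ a b : S, a = b → ((Functor.ofSequence (X := fun _ => S)
      fun _ => CommRingCat.ofHom (frobenius S p)).map (homOfLE j.le_succ)).hom a =
      ((Functor.ofSequence (X := fun _ => S)
      fun _ => CommRingCat.ofHom (frobenius S p)).map (homOfLE j.le_succ)).hom b :=
      fun a b h => by rw [h]
    refine h1.trans ((h3 _ _ ih).trans (h2.trans ?_))
    change (s ^ p ^ (j - i)) ^ p = _
    rw [← pow_mul, ← pow_succ, Nat.succ_sub hij]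

/-- The Frobenius towers are indexed by ℕ, which lives in universe 0. This gives access to the
elements of their colimits. -/
instance : PreservesFilteredColimitsOfSize.{0, 0} (forget CommRingCat.{u}) :=
  preservesFilteredColimitsOfSize_shrink.{0, u, 0, u} (forget CommRingCat.{u})

/-- The spectrum turns an isomorphism of colimits of rings into an isomorphism of limits of
schemes. -/
theorem isIso_limMap_spec {F G : ℕ ⥤ CommRingCat.{u}} (α : F ⟶ G) [IsIso (colimMap α)]
    [HasLimit (F.op ⋙ Scheme.Spec)] [HasLimit (G.op ⋙ Scheme.Spec)] :
    IsIso (limMap (Functor.whiskerRight (NatTrans.op α) Scheme.Spec)) := by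
  -- Spec sends colimits of rings to limits of schemes, so each limit of spectra is identified with
  -- the spectrum of the colimit.
  let hG := isLimitOfPreserves Scheme.Spec (colimit.isColimit G).op
  let hF := isLimitOfPreserves Scheme.Spec (colimit.isColimit F).op
  let eG : Spec (colimit G) ≅ limit (G.op ⋙ Scheme.Spec) :=
    hG.conePointUniqueUpToIso (limit.isLimit _)
  let eF : Spec (colimit F) ≅ limit (F.op ⋙ Scheme.Spec) :=
    hF.conePointUniqueUpToIso (limit.isLimit _)
  have key : eG.hom ≫ limMap (Functor.whiskerRight (NatTrans.op α) Scheme.Spec) =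
      Spec.map (colimMap α) ≫ eF.hom := by
    refine limit.hom_ext fun j => ?_
    have h1 : eG.hom ≫ limit.π (G.op ⋙ Scheme.Spec) j = Spec.map (colimit.ι G j.unop) :=
      hG.conePointUniqueUpToIso_hom_comp _ j
    have h2 : eF.hom ≫ limit.π (F.op ⋙ Scheme.Spec) j = Spec.map (colimit.ι F j.unop) :=
      hF.conePointUniqueUpToIso_hom_comp _ j
    rw [Category.assoc, Category.assoc, limMap_π, h2, ← Category.assoc, h1, ← Spec.map_comp,
      ι_colimMap α j.unop, Spec.map_comp]
    rfl
  rw [← Iso.eq_inv_comp] at key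
  rw [key]
  infer_instance

/-- An injective homomorphism whose cokernel is killed by powers of the Frobenius induces an
isomorphism of perfections. -/
theorem isIso_perfectionMap (p : ℕ) [Fact p.Prime] {S T : CommRingCat.{u}} [CharP S p] [CharP T p]
    (f : S ⟶ T) (hinj : Function.Injective f.hom) (hpow : ∀ t, ∃ n, ∃ s, f.hom s = t ^ p ^ n) :
    IsIso (perfectionMap p f) := by
  let FS : ℕ ⥤ CommRingCat.{u} :=
    Functor.ofSequence (X := fun _ => S) fun _ => CommRingCat.ofHom (frobenius S p)
  let FT : ℕ ⥤ CommRingCat.{u} :=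
    Functor.ofSequence (X := fun _ => T) fun _ => CommRingCat.ofHom (frobenius T p)
  let α : FS ⟶ FT := NatTrans.ofSequence (fun _ => f) fun n => by
    rw [Functor.ofSequence_map_homOfLE_succ, Functor.ofSequence_map_homOfLE_succ]
    ext x
    exact map_pow f.hom x p
  have hcol : IsIso (colimMap α) := by
    rw [ConcreteCategory.isIso_iff_bijective]
    have hι : ∀ n (s : S), (colimMap α) (colimit.ι FS n s) = colimit.ι FT n (f s) := by
      intro n s
      have := ι_colimMap α n
      exact ConcreteCategory.congr_hom this s
    have hker : ∀ (s : S) (m : ℕ), f s ^ m = 0 → s ^ m = 0 := fun s m h =>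
      hinj (((map_pow f.hom s m).trans h).trans (map_zero f.hom).symm)
    constructor
    · refine (injective_iff_map_eq_zero (colimMap α).hom).mpr fun x hx => ?_
      obtain ⟨n, s, rfl⟩ := Concrete.colimit_exists_rep FS x
      have hx' : colimit.ι FT n (f s) = colimit.ι FT n (0 : T) :=
        (hι n s).symm.trans (hx.trans (map_zero (colimit.ι FT n).hom).symm)
      -- Vanishing in the colimit means vanishing at a finite stage m, where f(s) has become
      -- f(s)^(p^(m-n)). Injectivity of f transfers this to s.
      obtain ⟨m, i, j, hij⟩ := (Concrete.colimit_rep_eq_iff_exists FT _ _).mp hx'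
      have hf : (f s) ^ p ^ (m - n) = 0 := by
        rw [← ofSequence_map_frobenius p T (leOfHom i)]
        exact hij.trans (map_zero (FT.map j).hom)
      have hs := hker s _ hf
      refine ((Concrete.colimit_rep_eq_iff_exists FS s (0 : S)).mpr ⟨m, i, j, ?_⟩).trans
        (map_zero (colimit.ι FS n).hom)
      refine (ofSequence_map_frobenius p S (leOfHom i) s).trans (hs.trans ?_)
      exact (map_zero (FS.map j).hom).symm
    · intro y
      obtain ⟨n, t, rfl⟩ := Concrete.colimit_exists_rep FT y
      obtain ⟨N, s, hs⟩ := hpow t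
      -- The element t of stage n becomes t^(p^N) = f(s) at stage n + N.
      refine ⟨colimit.ι FS (n + N) s, (hι _ _).trans ?_⟩
      refine (Concrete.colimit_rep_eq_iff_exists FT _ _).mpr
        ⟨n + N, homOfLE le_rfl, homOfLE (Nat.le_add_right n N), ?_⟩
      refine (ofSequence_map_frobenius p T le_rfl _).trans (Eq.trans ?_
        (ofSequence_map_frobenius p T (Nat.le_add_right n N) t).symm)
      rw [Nat.sub_self, pow_zero, pow_one, Nat.add_sub_cancel_left]
      exact hs
  exact isIso_limMap_spec α

/-- An injective homomorphism whose cokernel is killed by powers of the Frobenius induces a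
universal homeomorphism of spectra. -/
theorem isUniversalHomeomorphism_specMap (p : ℕ) [Fact p.Prime] {S T : CommRingCat.{u}}
    [CharP T p]
    (f : S ⟶ T) (hinj : Function.Injective f.hom) (hpow : ∀ t, ∃ n, ∃ s, f.hom s = t ^ p ^ n) :
    IsUniversalHomeomorphism (Spec.map f) := by
  -- Each t is a root of the monic polynomial X^(p^n) - s.
  have hint : f.hom.IsIntegral := fun t => by
    obtain ⟨n, s, hs⟩ := hpow t
    refine ⟨Polynomial.X ^ p ^ n - Polynomial.C s, Polynomial.monic_X_pow_sub_C s
      (pow_ne_zero n (Fact.out : p.Prime).ne_zero), ?_⟩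
    simp [hs]
  have : IsIntegralHom (Spec.map f) := IsIntegralHom.SpecMap_iff.mpr hint
  have hs : Surjective (Spec.map f) :=
    (surjective_iff _).mpr (hint.comap_surjective hinj)
  -- Universal injectivity is tested on points with values in fields K. Two such points agreeing on
  -- S agree on t^(p^n), and the p^n-power map of a field of characteristic p is injective.
  have hu : UniversallyInjective (Spec.map f) := by
    refine ((tfae_universallyInjective (Spec.map f)).out 0 1).mpr ?_
    intro K _ g₁ g₂ hg
    obtain ⟨g₁, rfl⟩ := Spec.map_surjective g₁
    obtain ⟨g₂, rfl⟩ := Spec.map_surjective g₂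
    simp only [← Spec.map_comp] at hg
    have hg := Spec.map_injective hg
    congr 1
    ext t
    obtain ⟨n, s, hs⟩ := hpow t
    have : CharP K p := (CharP.charP_iff_prime_eq_zero (Fact.out : p.Prime)).mpr (by
      rw [← map_natCast g₁.hom, CharP.cast_eq_zero, map_zero])
    refine iterateFrobenius_inj K p n ?_
    rw [iterateFrobenius_def, iterateFrobenius_def, ← map_pow, ← map_pow, ← hs]
    exact ConcreteCategory.congr_hom hg s
  -- Integrality, surjectivity and universal injectivity survive base change, and an integral
  -- morphism is closed. Every base change is therefore a continuous closed bijection.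
  intro X' Y' i₁ i₂ f' hp
  have h1 : UniversallyInjective f' := MorphismProperty.of_isPullback hp.flip hu
  have h2 : IsIntegralHom f' := MorphismProperty.of_isPullback hp.flip ‹_›
  have h3 : Surjective f' := MorphismProperty.of_isPullback hp.flip hs
  exact isHomeomorph_iff_continuous_isClosedMap_bijective.mpr
    ⟨f'.continuous, f'.isClosedMap, f'.injective, f'.surjective⟩

end FIso

/-! ### Functoriality of truncated Witt vectors -/

namespace TruncatedWittVector

variable {p : ℕ} [Fact p.Prime] {n : ℕ} {R S : Type*} [CommRing R] [CommRing S]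

/-- Any lift y to full Witt vectors computes the componentwise map, which thus inherits additivity
from `WittVector.map`. -/
theorem truncate_map_eq (f : R →+* S) (x : TruncatedWittVector p n R) (y : WittVector p R)
    (h : WittVector.truncate n y = x) :
    WittVector.truncate n (WittVector.map f y) = mk p fun i => f (x.coeff i) := by
  subst h
  ext i
  simp [WittVector.coeff_truncate, WittVector.map_coeff]

variable (n) in
/-- The additive map on truncated Witt vectors induced by a ring homomorphism. -/
noncomputable def mapAddHom (f : R →+* S) :
    TruncatedWittVector p n R →+ TruncatedWittVector p n S where
  toFun x := mk p fun i => f (x.coeff i)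
  map_zero' := by
    rw [← truncate_map_eq f 0 0 (map_zero _), map_zero, map_zero]
  map_add' x y := by
    obtain ⟨x, rfl⟩ := WittVector.truncate_surjective p n R x
    obtain ⟨y, rfl⟩ := WittVector.truncate_surjective p n R y
    rw [← map_add, ← truncate_map_eq f _ _ rfl, ← truncate_map_eq f _ _ rfl,
      ← truncate_map_eq f _ _ rfl, map_add, map_add]

theorem coeff_mapAddHom (f : R →+* S) (x : TruncatedWittVector p n R) (i : Fin n) :
    (mapAddHom n f x).coeff i = f (x.coeff i) := coeff_mk _ _

theorem mapAddHom_truncate (f : R →+* S) (x : WittVector p R) :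
    mapAddHom n f (WittVector.truncate n x) = WittVector.truncate n (WittVector.map f x) :=
  (truncate_map_eq f _ _ rfl).symm

end TruncatedWittVector

/-! ### Closed subgroups of products of Witt vector groups -/

namespace WittLocus

variable (p : ℕ) [Fact p.Prime] {k : Type u} [Field k] {ι : Type}

section Points

variable {A B : Type u} [CommRing A] [Algebra k A] [CommRing B] [Algebra k B]

variable (k) in
/-- Evaluation of polynomials at the components of a family of Witt vectors. -/
noncomputable def eval (x : ι → WittVector p A) : MvPolynomial (ι × ℕ) k →ₐ[k] A :=
  MvPolynomial.aeval fun j => (x j.1).coeff j.2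

variable (k) in
/-- Evaluation of polynomials at the components of a family of truncated Witt vectors. -/
noncomputable def evalTrunc {n : ℕ} (x : ι → TruncatedWittVector p n A) :
    MvPolynomial (ι × Fin n) k →ₐ[k] A :=
  MvPolynomial.aeval fun j => (x j.1).coeff j.2

variable (k ι) in
/-- The inclusion of the polynomials in the first `n` components. -/
noncomputable def incl (n : ℕ) : MvPolynomial (ι × Fin n) k →ₐ[k] MvPolynomial (ι × ℕ) k :=
  MvPolynomial.rename (Prod.map id Fin.val)

theorem eval_incl {n : ℕ} (x : ι → WittVector p A) (P : MvPolynomial (ι × Fin n) k) :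
    eval p k x (incl k ι n P) = evalTrunc p k (fun i => WittVector.truncate n (x i)) P := by
  rw [eval, incl, MvPolynomial.aeval_rename, evalTrunc]
  congr 2

theorem eval_map (f : A →ₐ[k] B) (x : ι → WittVector p A) (P : MvPolynomial (ι × ℕ) k) :
    eval p k (fun i => WittVector.map (f : A →+* B) (x i)) P = f (eval p k x P) := by
  rw [eval, eval, ← AlgHom.comp_apply, MvPolynomial.comp_aeval]
  rfl

theorem evalTrunc_map {n : ℕ} (f : A →ₐ[k] B) (x : ι → TruncatedWittVector p n A)
    (P : MvPolynomial (ι × Fin n) k) :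
    evalTrunc p k (fun i => TruncatedWittVector.mapAddHom n (f : A →+* B) (x i)) P =
      f (evalTrunc p k x P) := by
  rw [evalTrunc, evalTrunc, ← AlgHom.comp_apply, MvPolynomial.comp_aeval]
  congr 2

end Points

variable (I : Ideal (MvPolynomial (ι × ℕ) k))

/-- The families of Witt vectors whose components are killed by the ideal `I`. -/
def locus (A : Type u) [CommRing A] [Algebra k A] : Set (ι → WittVector p A) :=
  {x | ∀ P ∈ I, eval p k x P = 0}

/-- The families of truncated Witt vectors whose components are killed by the polynomials in the
ideal `I`. -/
def locusTrunc (n : ℕ) (A : Type u) [CommRing A] [Algebra k A] :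
    Set (ι → TruncatedWittVector p n A) :=
  {x | ∀ P ∈ I.comap (incl k ι n), evalTrunc p k x P = 0}

/-- The ideal `I` defines a subgroup of a product of Witt vector groups. -/
structure IsSubgroupIdeal : Prop where
  zero_mem : ∀ (A : Type u) [CommRing A] [Algebra k A], 0 ∈ locus p I A
  add_mem : ∀ (A : Type u) [CommRing A] [Algebra k A] {x y}, x ∈ locus p I A → y ∈ locus p I A →
    x + y ∈ locus p I A
  neg_mem : ∀ (A : Type u) [CommRing A] [Algebra k A] {x}, x ∈ locus p I A → -x ∈ locus p I A

theorem map_mem_locus {A B : Type u} [CommRing A] [Algebra k A] [CommRing B] [Algebra k B]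
    (f : A →ₐ[k] B) {x : ι → WittVector p A} (hx : x ∈ locus p I A) :
    (fun i => WittVector.map (f : A →+* B) (x i)) ∈ locus p I B := fun P hP => by
  rw [eval_map, hx P hP, map_zero]

theorem map_mem_locusTrunc {A B : Type u} [CommRing A] [Algebra k A] [CommRing B] [Algebra k B]
    (f : A →ₐ[k] B) {n : ℕ} {x : ι → TruncatedWittVector p n A} (hx : x ∈ locusTrunc p I n A) :
    (fun i => TruncatedWittVector.mapAddHom n (f : A →+* B) (x i)) ∈ locusTrunc p I n B :=
  fun P hP => by rw [evalTrunc_map, hx P hP, map_zero]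

theorem truncate_mem_locusTrunc {A : Type u} [CommRing A] [Algebra k A] (n : ℕ)
    {x : ι → WittVector p A} (hx : x ∈ locus p I A) :
    (fun i => WittVector.truncate n (x i)) ∈ locusTrunc p I n A := fun P hP => by
  rw [← eval_incl]
  exact hx _ hP

theorem truncate_mem_locusTrunc_of_le {A : Type u} [CommRing A] [Algebra k A] {m n : ℕ}
    (hmn : n ≤ m) {x : ι → TruncatedWittVector p m A} (hx : x ∈ locusTrunc p I m A) :
    (fun i => TruncatedWittVector.truncate hmn (x i)) ∈ locusTrunc p I n A := by
  intro P hP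
  -- These lifts serve only to compare evaluations at the two lengths. They need not lie in the
  -- locus.
  choose y hy using fun i => WittVector.truncate_surjective p m A (x i)
  let Q : MvPolynomial (ι × Fin m) k := MvPolynomial.rename (Prod.map id (Fin.castLE hmn)) P
  have hQ : incl k ι m Q = incl k ι n P := by
    simp only [incl, Q, MvPolynomial.rename_rename]
    rfl
  have h1 : evalTrunc p k x Q = 0 := hx Q (by rw [Ideal.mem_comap, hQ]; exact hP)
  have h2 : x = fun i => WittVector.truncate m (y i) := funext fun i => (hy i).symm
  rw [h2, ← eval_incl, hQ, eval_incl] at h1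
  rw [h2]
  simpa only [TruncatedWittVector.truncate_wittVector_truncate] using h1

/-- If all the truncations of a family of Witt vectors are killed by the polynomials in `I`,
then so is the family. -/
theorem mem_locus_of_forall_truncate {A : Type u} [CommRing A] [Algebra k A] [Finite ι]
    {x : ι → WittVector p A}
    (hx : ∀ n, (fun i => WittVector.truncate n (x i)) ∈ locusTrunc p I n A) : x ∈ locus p I A := by
  intro P hP
  obtain ⟨n, Q, rfl⟩ : ∃ n, ∃ Q, incl k ι n Q = P := by
    -- A polynomial involves finitely many variables, so it only sees components of index below this
    -- n.
    let n := P.vars.sup Prod.snd + 1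
    have hv : ∀ j ∈ P.vars, j.2 < n := fun j hj => Nat.lt_succ_of_le (Finset.le_sup hj)
    refine ⟨n, ?_⟩
    obtain ⟨Q, hQ⟩ := MvPolynomial.exists_rename_eq_of_vars_subset_range P
      (Prod.map id Fin.val : ι × Fin n → ι × ℕ)
      (Function.Injective.prodMap Function.injective_id Fin.val_injective)
      (fun j hj => ⟨(j.1, ⟨j.2, hv j hj⟩), rfl⟩)
    exact ⟨Q, hQ⟩
  rw [eval_incl]
  exact hx n Q hP

/-- A point of the truncated locus lifts to a point of the locus after replacing the algebra by
another one that maps to it, and then by a larger one. -/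
theorem mem_locusTrunc_iff {A : Type u} [CommRing A] [Algebra k A] (n : ℕ)
    (x : ι → TruncatedWittVector p n A) :
    x ∈ locusTrunc p I n A ↔
      ∃ (D : Type u) (_ : CommRing D) (_ : Algebra k D) (E : Type u) (_ : CommRing E)
        (_ : Algebra k E) (d : D →ₐ[k] A) (g : D →ₐ[k] E) (y : ι → TruncatedWittVector p n D)
        (z : ι → WittVector p E), Function.Injective g ∧ z ∈ locus p I E ∧
        (∀ i, TruncatedWittVector.mapAddHom n (d : D →+* A) (y i) = x i) ∧
        ∀ i, TruncatedWittVector.mapAddHom n (g : D →+* E) (y i) = WittVector.truncate n (z i) := by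
  constructor
  · intro hx
    let J := I.comap (incl k ι n)
    -- The universal case: D and E are the coordinate rings of the truncated locus and of the locus,
    -- y and z their tautological points, and d the evaluation at x. The map from D to E is
    -- injective because J is the contraction of I.
    refine ⟨MvPolynomial (ι × Fin n) k ⧸ J, inferInstance, inferInstance,
      MvPolynomial (ι × ℕ) k ⧸ I, inferInstance, inferInstance,
      Ideal.Quotient.liftₐ J (evalTrunc p k x) hx, Ideal.quotientMapₐ I (incl k ι n) le_rfl,
      fun i => TruncatedWittVector.mk p fun m => Ideal.Quotient.mk J (MvPolynomial.X (i, m)),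
      fun i => WittVector.mk p fun m => Ideal.Quotient.mk I (MvPolynomial.X (i, m)),
      Ideal.quotientMap_injective, ?_, fun i => ?_, fun i => ?_⟩
    · intro P hP
      have : eval p k (fun i => WittVector.mk p fun m =>
          Ideal.Quotient.mk I (MvPolynomial.X (i, m))) = Ideal.Quotient.mkₐ k I := by
        ext j
        simp [eval]
      rw [this]
      exact Ideal.Quotient.eq_zero_iff_mem.mpr hP
    · ext m
      rw [TruncatedWittVector.coeff_mapAddHom, TruncatedWittVector.coeff_mk]
      exact MvPolynomial.aeval_X _ _
    · ext m
      rw [TruncatedWittVector.coeff_mapAddHom, TruncatedWittVector.coeff_mk,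
        WittVector.coeff_truncate]
      exact congrArg (Ideal.Quotient.mk I) (MvPolynomial.rename_X _ _)
  · rintro ⟨D, _, _, E, _, _, d, g, y, z, hg, hz, hy, hyz⟩ P hP
    rw [← funext hy, evalTrunc_map]
    -- The equations hold for the truncation of z, and the injectivity of g brings them back to y.
    have : evalTrunc p k y P = 0 := hg (by
      rw [← evalTrunc_map, funext hyz, map_zero]
      exact truncate_mem_locusTrunc p I n hz P hP)
    rw [this, map_zero]

/-! ### The truncated loci are subgroups. -/

variable {I} (hI : IsSubgroupIdeal p I)

include hI in
theorem zero_mem_locusTrunc (n : ℕ) (A : Type u) [CommRing A] [Algebra k A] :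
    0 ∈ locusTrunc p I n A := by
  have := truncate_mem_locusTrunc p I n (hI.zero_mem A)
  simp only [Pi.zero_apply, map_zero] at this
  exact this

include hI in
theorem neg_mem_locusTrunc {n : ℕ} {A : Type u} [CommRing A] [Algebra k A]
    {x : ι → TruncatedWittVector p n A} (hx : x ∈ locusTrunc p I n A) :
    -x ∈ locusTrunc p I n A := by
  obtain ⟨D, _, _, E, _, _, d, g, y, z, hg, hz, hy, hyz⟩ := (mem_locusTrunc_iff p I n x).mp hx
  refine (mem_locusTrunc_iff p I n _).mpr ⟨D, _, _, E, _, _, d, g, -y, -z, hg, hI.neg_mem E hz,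
    fun i => ?_, fun i => ?_⟩
  · rw [Pi.neg_apply, Pi.neg_apply, map_neg, hy]
  · rw [Pi.neg_apply, Pi.neg_apply, map_neg, map_neg, hyz]

-- A truncated point need not lift over A, so addition is carried out on the lifts given by
-- `mem_locusTrunc_iff`. The two points come with different injections D → E and D' → E'. Over the
-- field k everything is flat, so D ⊗ D' → E ⊗ E' is again injective, and the sum of the lifts lies
-- in the locus over E ⊗ E'.
include hI in
theorem add_mem_locusTrunc {n : ℕ} {A : Type u} [CommRing A] [Algebra k A]
    {x x' : ι → TruncatedWittVector p n A} (hx : x ∈ locusTrunc p I n A)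
    (hx' : x' ∈ locusTrunc p I n A) : x + x' ∈ locusTrunc p I n A := by
  obtain ⟨D, _, _, E, _, _, d, g, y, z, hg, hz, hy, hyz⟩ := (mem_locusTrunc_iff p I n x).mp hx
  obtain ⟨D', _, _, E', _, _, d', g', y', z', hg', hz', hy', hyz'⟩ :=
    (mem_locusTrunc_iff p I n x').mp hx'
  let dd : D ⊗[k] D' →ₐ[k] A := Algebra.TensorProduct.lift d d' fun _ _ => Commute.all _ _
  let gg : D ⊗[k] D' →ₐ[k] E ⊗[k] E' := Algebra.TensorProduct.map g g'
  let l : D →ₐ[k] D ⊗[k] D' := Algebra.TensorProduct.includeLeft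
  let r : D' →ₐ[k] D ⊗[k] D' := Algebra.TensorProduct.includeRight
  let L : E →ₐ[k] E ⊗[k] E' := Algebra.TensorProduct.includeLeft
  let R : E' →ₐ[k] E ⊗[k] E' := Algebra.TensorProduct.includeRight
  refine (mem_locusTrunc_iff p I n _).mpr ⟨D ⊗[k] D', inferInstance, inferInstance,
    E ⊗[k] E', inferInstance, inferInstance, dd, gg,
    (fun i => TruncatedWittVector.mapAddHom n (l : D →+* D ⊗[k] D') (y i)) +
      (fun i => TruncatedWittVector.mapAddHom n (r : D' →+* D ⊗[k] D') (y' i)),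
    (fun i => WittVector.map (L : E →+* E ⊗[k] E') (z i)) +
      (fun i => WittVector.map (R : E' →+* E ⊗[k] E') (z' i)),
    TensorProduct.map_injective_of_flat_flat g.toLinearMap g'.toLinearMap hg hg',
    hI.add_mem _ (map_mem_locus p I L hz) (map_mem_locus p I R hz'), fun i => ?_, fun i => ?_⟩
  · rw [Pi.add_apply, map_add, Pi.add_apply, ← hy, ← hy']
    congr 1 <;> ext m <;> simp only [TruncatedWittVector.coeff_mapAddHom]
    · simp [dd, l]
    · simp [dd, r]
  · rw [Pi.add_apply, map_add, Pi.add_apply, map_add, ← TruncatedWittVector.mapAddHom_truncate,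
      ← TruncatedWittVector.mapAddHom_truncate, ← hyz, ← hyz']
    congr 1 <;> ext m <;> simp only [TruncatedWittVector.coeff_mapAddHom]
    · simp [gg, l, L]
    · simp [gg, r, R]

/-- The subgroup of families of Witt vectors defined by `I`. -/
def subgroup (A : Type u) [CommRing A] [Algebra k A] : AddSubgroup (ι → WittVector p A) where
  carrier := locus p I A
  zero_mem' := hI.zero_mem A
  add_mem' := hI.add_mem A
  neg_mem' := hI.neg_mem A

/-- The subgroup of families of truncated Witt vectors defined by `I`. -/
def subgroupTrunc (n : ℕ) (A : Type u) [CommRing A] [Algebra k A] :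
    AddSubgroup (ι → TruncatedWittVector p n A) where
  carrier := locusTrunc p I n A
  zero_mem' := zero_mem_locusTrunc p hI n A
  add_mem' := add_mem_locusTrunc p hI
  neg_mem' := neg_mem_locusTrunc p hI

/-! ### The group defined by an ideal as the limit of its truncations. -/

/-- The commutative group defined by `I`. -/
noncomputable def group : CommAlgCat.{u} k ⥤ AddCommGrpCat.{u} where
  obj A := AddCommGrpCat.of (subgroup p hI A)
  map {A B} f := AddCommGrpCat.ofHom
    { toFun := fun x => ⟨fun i => WittVector.map (f.hom : A →+* B) (x.1 i),
        map_mem_locus p I f.hom x.2⟩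
      map_zero' := Subtype.ext (funext fun _ => map_zero _)
      map_add' := fun _ _ => Subtype.ext (funext fun _ => map_add _ _ _) }
  map_id A := by
    ext x
    rfl
  map_comp f g := by
    ext x
    rfl

/-- The truncations of the commutative group defined by `I`. -/
noncomputable def groupTrunc (n : ℕ) : CommAlgCat.{u} k ⥤ AddCommGrpCat.{u} where
  obj A := AddCommGrpCat.of (subgroupTrunc p hI n A)
  map {A B} f := AddCommGrpCat.ofHom
    { toFun := fun x => ⟨fun i => TruncatedWittVector.mapAddHom n (f.hom : A →+* B) (x.1 i),
        map_mem_locusTrunc p I f.hom x.2⟩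
      map_zero' := Subtype.ext (funext fun _ => map_zero _)
      map_add' := fun _ _ => Subtype.ext (funext fun _ => map_add _ _ _) }
  map_id A := by
    ext x
    rfl
  map_comp f g := by
    ext x
    rfl

/-- The transition homomorphisms between the truncations. -/
noncomputable def transition {m n : ℕ} (hmn : n ≤ m) : groupTrunc p hI m ⟶ groupTrunc p hI n where
  app A := AddCommGrpCat.ofHom
    { toFun := fun x => ⟨fun i => TruncatedWittVector.truncate hmn (x.1 i),
        truncate_mem_locusTrunc_of_le p I hmn x.2⟩
      map_zero' := Subtype.ext (funext fun _ => map_zero _)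
      map_add' := fun _ _ => Subtype.ext (funext fun _ => map_add _ _ _) }
  naturality A B f := by
    ext x
    refine Subtype.ext (funext fun i => TruncatedWittVector.ext fun j => ?_)
    change (TruncatedWittVector.truncate hmn (TruncatedWittVector.mapAddHom m _ _)).coeff j =
      (TruncatedWittVector.mapAddHom n _ (TruncatedWittVector.truncate hmn _)).coeff j
    simp only [TruncatedWittVector.coeff_truncate, TruncatedWittVector.coeff_mapAddHom]

/-- The homomorphisms to the truncations. -/
noncomputable def toTrunc (n : ℕ) : group p hI ⟶ groupTrunc p hI n where
  app A := AddCommGrpCat.ofHom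
    { toFun := fun x => ⟨fun i => WittVector.truncate n (x.1 i),
        truncate_mem_locusTrunc p I n x.2⟩
      map_zero' := Subtype.ext (funext fun _ => map_zero _)
      map_add' := fun _ _ => Subtype.ext (funext fun _ => map_add _ _ _) }
  naturality A B f := by
    ext x
    exact Subtype.ext (funext fun i => (TruncatedWittVector.mapAddHom_truncate _ _).symm)

/-- The inverse system of the truncations. -/
noncomputable def tower : (ULift.{u} ℕ)ᵒᵖ ⥤ CommAlgCat.{u} k ⥤ AddCommGrpCat.{u} where
  -- The index set ℕ is lifted to universe u because `IsProInfinitesimal` asks for a small category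
  -- there.
  obj n := groupTrunc p hI n.unop.down
  map f := transition p hI (ULift.down_le.mpr (leOfHom f.unop))
  map_id n := by
    ext A x
    exact Subtype.ext (funext fun i => TruncatedWittVector.ext fun j =>
      TruncatedWittVector.coeff_truncate _ _ _)
  map_comp f g := by
    ext A x
    refine Subtype.ext (funext fun i => ?_)
    exact (TruncatedWittVector.truncate_truncate (ULift.down_le.mpr (leOfHom g.unop))
      (ULift.down_le.mpr (leOfHom f.unop)) _).symm

/-- The group defined by `I` as a cone over its truncations. -/
noncomputable def towerCone : Cone (tower p hI) where
  pt := group p hI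
  π :=
    { app := fun n => toTrunc p hI n.unop.down
      naturality := fun m n f => by
        ext A x
        exact Subtype.ext (funext fun i =>
          (TruncatedWittVector.truncate_wittVector_truncate _ _).symm) }

/-- Limits of functors are computed pointwise, and the forgetful functor to sets reflects them. It
remains to glue compatible truncated vectors to a Witt vector, whose membership in the locus can be
checked on truncations. -/
theorem nonempty_isLimit_towerCone [Finite ι] : Nonempty (IsLimit (towerCone p hI)) := by
  refine ⟨evaluationJointlyReflectsLimits _ fun A =>
    isLimitOfReflects (forget AddCommGrpCat) (Nonempty.some ?_)⟩
  rw [Types.isLimit_iff]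
  intro s hs
  let t : ∀ n : ℕ, subgroupTrunc p hI n A := fun n => s (Opposite.op ⟨n⟩)
  have ht : ∀ {m n : ℕ} (hmn : n ≤ m) (i : ι),
      TruncatedWittVector.truncate hmn ((t m).1 i) = (t n).1 i := by
    intro m n hmn i
    have h : (Opposite.op (ULift.up m) : (ULift.{u} ℕ)ᵒᵖ) ⟶ Opposite.op ⟨n⟩ :=
      (homOfLE (show (ULift.up n : ULift.{u} ℕ) ≤ ULift.up m from hmn)).op
    exact congrFun (congrArg Subtype.val (hs h)) i
  -- The component of index m is read off in length m + 1, the shortest truncation that contains it.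
  let x : ι → WittVector p A := fun i => WittVector.mk p fun m =>
    ((t (m + 1)).1 i).coeff (Fin.last m)
  have hx : ∀ n i, WittVector.truncate n (x i) = (t n).1 i := by
    intro n i
    ext j
    rw [WittVector.coeff_truncate]
    change ((t (j + 1)).1 i).coeff (Fin.last j) = _
    rw [← ht (show (j : ℕ) + 1 ≤ n from j.2), TruncatedWittVector.coeff_truncate]
    rfl
  have hxm : x ∈ locus p I A := mem_locus_of_forall_truncate p I fun n => by
    rw [funext (hx n)]
    exact (t n).2
  refine ⟨(⟨x, hxm⟩ : subgroup p hI A), fun j => Subtype.ext (funext fun i => hx _ i),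
    fun y hy => ?_⟩
  refine Subtype.ext (funext fun i => WittVector.ext fun m => ?_)
  have h1 : WittVector.truncate (m + 1) ((y : subgroup p hI A).1 i) = (t (m + 1)).1 i :=
    congrFun (congrArg Subtype.val (hy (Opposite.op ⟨m + 1⟩))) i
  have h2 := congrArg (fun z => TruncatedWittVector.coeff (Fin.last m) z) h1
  simp only [WittVector.coeff_truncate] at h2
  exact h2

/-! ### The truncations are finite and local when the variables are nilpotent. -/

/-- The coordinate ring of a truncation. -/
abbrev truncRing (I : Ideal (MvPolynomial (ι × ℕ) k)) (n : ℕ) : Type u :=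
  MvPolynomial (ι × Fin n) k ⧸ I.comap (incl k ι n)

/-- The truncations are representable. -/
noncomputable def groupTruncCorepresentableBy (n : ℕ) :
    (groupTrunc p hI n ⋙ forget AddCommGrpCat).CorepresentableBy
      (CommAlgCat.of k (truncRing I n)) where
  homEquiv {A} :=
    { toFun := fun f => (⟨fun i => TruncatedWittVector.mk p fun m =>
          f.hom (Ideal.Quotient.mk _ (MvPolynomial.X (i, m))), fun P hP => by
          have : evalTrunc p k (fun i => TruncatedWittVector.mk p fun m =>
              f.hom (Ideal.Quotient.mk _ (MvPolynomial.X (i, m)))) =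
              f.hom.comp (Ideal.Quotient.mkₐ k (I.comap (incl k ι n))) := by
            ext j
            simp [evalTrunc]
          rw [this, AlgHom.comp_apply]
          refine (congrArg f.hom (Ideal.Quotient.eq_zero_iff_mem.mpr hP)).trans (map_zero _)⟩ :
            subgroupTrunc p hI n A)
      invFun := fun x => CommAlgCat.ofHom (Ideal.Quotient.liftₐ _
        (evalTrunc p k (x : subgroupTrunc p hI n A).1) (x : subgroupTrunc p hI n A).2)
      left_inv := fun f => CommAlgCat.hom_ext (Ideal.Quotient.algHom_ext k
        (MvPolynomial.algHom_ext fun j => MvPolynomial.aeval_X _ _))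
      right_inv := fun x => Subtype.ext (funext fun i => TruncatedWittVector.ext fun m =>
        MvPolynomial.aeval_X _ _) }
  homEquiv_comp f g := rfl

-- The zero family is a point of the locus over k, where the polynomial 1 does not vanish.
include hI in
theorem ne_top : I ≠ ⊤ := by
  intro h
  have := hI.zero_mem k 1 (h ▸ Submodule.mem_top)
  rw [map_one] at this
  exact one_ne_zero this

/-- The nilradical is an ideal containing the classes of all variables, so it contains every
polynomial without constant term. -/
theorem isNilpotent_sub_constantCoeff (hnil : ∀ j, ∃ m, (MvPolynomial.X j) ^ m ∈ I) (n : ℕ)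
    (P : MvPolynomial (ι × Fin n) k) :
    IsNilpotent (Ideal.Quotient.mk (I.comap (incl k ι n)) P -
      algebraMap k (truncRing I n) (MvPolynomial.constantCoeff P)) := by
  rw [← mem_nilradical]
  induction P using MvPolynomial.induction_on with
  | C a =>
    rw [MvPolynomial.constantCoeff_C]
    convert Ideal.zero_mem _
    exact sub_self _
  | add P Q hP hQ =>
    rw [map_add, map_add, map_add, add_sub_add_comm]
    exact Ideal.add_mem _ hP hQ
  | mul_X P j hP =>
    rw [map_mul, map_mul, MvPolynomial.constantCoeff_X, mul_zero, map_zero, sub_zero]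
    refine Ideal.mul_mem_left _ _ ?_
    obtain ⟨m, hm⟩ := hnil (j.1, j.2)
    refine mem_nilradical.mpr ⟨m, ?_⟩
    rw [← map_pow, Ideal.Quotient.eq_zero_iff_mem, Ideal.mem_comap, map_pow, incl,
      MvPolynomial.rename_X]
    exact hm

/-- Every element of the coordinate ring is a constant plus a nilpotent. It is thus integral over k,
and finitely many variables generate, which gives finiteness. The ring is local because such an
element is a unit if the constant is nonzero, while 1 - a is a unit otherwise. -/
theorem isInfinitesimal_groupTrunc [Finite ι] (hnil : ∀ j, ∃ m, (MvPolynomial.X j) ^ m ∈ I)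
    (n : ℕ) : IsInfinitesimal (groupTrunc p hI n) := by
  have key : ∀ a : truncRing I n, ∃ c : k, IsNilpotent (a - algebraMap k (truncRing I n) c) := by
    intro a
    obtain ⟨P, rfl⟩ := Ideal.Quotient.mk_surjective a
    exact ⟨_, isNilpotent_sub_constantCoeff hnil n P⟩
  refine ⟨CommAlgCat.of k (truncRing I n), ⟨groupTruncCorepresentableBy p hI n⟩, ?_, ?_⟩
  · have : Algebra.IsIntegral k (truncRing I n) := ⟨fun a => by
      obtain ⟨c, m, hm⟩ := key a
      refine ⟨(Polynomial.X - Polynomial.C c) ^ m, (Polynomial.monic_X_sub_C c).pow m, ?_⟩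
      simpa using hm⟩
    exact Algebra.IsIntegral.finite (R := k) (A := truncRing I n)
  · have : Nontrivial (truncRing I n) := Ideal.Quotient.nontrivial_iff.mpr
      (Ideal.comap_ne_top _ (ne_top p hI))
    refine IsLocalRing.of_isUnit_or_isUnit_one_sub_self fun a : truncRing I n => ?_
    obtain ⟨c, hc⟩ := key a
    by_cases h : c = 0
    · right
      rw [h, map_zero, sub_zero] at hc
      exact hc.isUnit_one_sub
    · left
      have h1 : IsUnit (algebraMap k (truncRing I n) c) := (IsUnit.mk0 c h).map _
      have h2 := hc.isUnit_add_left_of_commute h1 (Commute.all _ _)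
      rwa [add_sub_cancel] at h2

theorem isProInfinitesimal_group [Finite ι] (hnil : ∀ j, ∃ m, (MvPolynomial.X j) ^ m ∈ I) :
    IsProInfinitesimal (group p hI) :=
  ⟨(ULift.{u} ℕ)ᵒᵖ, inferInstance, inferInstance, tower p hI, towerCone p hI,
    nonempty_isLimit_towerCone p hI, ⟨Iso.refl _⟩, fun n =>
      isInfinitesimal_groupTrunc p hI hnil n.unop.down⟩

end WittLocus

/-! ### The kernel of the comparison morphism -/

section Kernel

open RamifiedWitt

variable (p : ℕ) [Fact p.Prime] {O : Type u} [CommRing O] [IsDomain O]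
  [IsDiscreteValuationRing O] [Finite (ResidueField O)] [IsAdicComplete (maximalIdeal O) O]
  [CharP (ResidueField O) p] (ϖ : Uniformizer O) [CharZero O]

attribute [local instance] wittAlgebra wittMapAlgebra rwittAlgebra

variable (O) in
/-- The coordinates in the chosen basis, as an isomorphism of additive groups. -/
noncomputable def greenbergCoordAddEquiv (A : Type v) [CommRing A] [Algebra (ResidueField O) A] :
    (Fin (absRamification p O) → WittVector p A) ≃+
      O ⊗[WittVector p (ResidueField O)] WittVector p A :=
  { greenbergCoord p O A with
    map_add' := fun x y => by
      change greenbergCoord p O A (x + y) = greenbergCoord p O A x + greenbergCoord p O A y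
      simp only [greenbergCoord_apply, Pi.add_apply, TensorProduct.tmul_add,
        Finset.sum_add_distrib] }

/-- The ideal of the kernel of the comparison morphism. -/
noncomputable def kernelIdeal : Ideal (greenbergRing p O) :=
  Ideal.span (Set.range fun n => (comparisonCoord p ϖ).hom (MvPolynomial.X n))

/-- The components of the image under r_A of the point with coordinates x are the values at x of the
polynomials r^*(X_n), which generate the ideal. -/
theorem greenbergCoord_mem_ker_iff (A : CommAlgCat.{u} (ResidueField O))
    (x : Fin (absRamification p O) → WittVector p A) :
    greenbergCoordAddEquiv p O A x ∈ RingHom.ker ((comparison p ϖ).app A).hom ↔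
      x ∈ WittLocus.locus p (kernelIdeal p ϖ) A := by
  have h := comparisonCoord_points p ϖ A (CommAlgCat.ofHom (WittLocus.eval p (ResidueField O) x))
  have hpt : (greenbergCorepresentableBy p O).homEquiv
      (CommAlgCat.ofHom (WittLocus.eval p (ResidueField O) x) : _ ⟶ A) =
      greenbergCoordAddEquiv p O A x := by
    refine congrArg (greenbergCoord p O A) (funext fun i => WittVector.ext fun n => ?_)
    exact MvPolynomial.aeval_X _ _
  rw [hpt] at h
  have hmem : greenbergCoordAddEquiv p O A x ∈ RingHom.ker ((comparison p ϖ).app A).hom ↔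
      ∀ n, WittLocus.eval p (ResidueField O) x
        ((comparisonCoord p ϖ).hom (MvPolynomial.X n)) = 0 :=
    ⟨fun h2 n => congrArg (fun z : RWitt ϖ A => z.coeff n) (h.trans h2),
      fun h2 => h.symm.trans (RWitt.ext (funext h2))⟩
  rw [hmem]
  constructor
  · intro h2 P hP
    have : kernelIdeal p ϖ ≤ RingHom.ker (WittLocus.eval p (ResidueField O) x) := by
      rw [kernelIdeal, Ideal.span_le]
      rintro _ ⟨n, rfl⟩
      exact h2 n
    exact this hP
  · intro h2 n
    exact h2 _ (Ideal.subset_span ⟨n, rfl⟩)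

/-- The group laws are not checked on polynomials: they are transported from the ideal ker r_A. -/
theorem isSubgroupIdeal_kernelIdeal : WittLocus.IsSubgroupIdeal p (kernelIdeal p ϖ) where
  zero_mem A _ _ := by
    have h := greenbergCoord_mem_ker_iff p ϖ (CommAlgCat.of _ A)
    refine (h 0).mp ?_
    rw [map_zero]
    exact Ideal.zero_mem _
  add_mem A _ _ x y hx hy := by
    have h := greenbergCoord_mem_ker_iff p ϖ (CommAlgCat.of _ A)
    refine (h (x + y)).mp ?_
    rw [map_add]
    exact Ideal.add_mem _ ((h x).mpr hx) ((h y).mpr hy)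
  neg_mem A _ _ x hx := by
    have h := greenbergCoord_mem_ker_iff p ϖ (CommAlgCat.of _ A)
    refine (h (-x)).mp ?_
    rw [map_neg]
    exact neg_mem ((h x).mpr hx)

/-- Some power X_j^(p^n) equals r^*(s). Modulo the kernel ideal, r^* sends s to its constant term c,
so X_j^(p^n) - c lies in the ideal. Evaluating at the zero element of the group shows that c = 0. -/
theorem exists_X_pow_mem_kernelIdeal (j : Fin (absRamification p O) × ℕ) :
    ∃ m, (MvPolynomial.X j : greenbergRing p O) ^ m ∈ kernelIdeal p ϖ := by
  obtain ⟨n, s, hs⟩ := (comparisonCoord_injective_and_exists_pow p ϖ).2 (MvPolynomial.X j)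
  refine ⟨p ^ n, ?_⟩
  let I := kernelIdeal p ϖ
  -- Both homomorphisms kill every variable, since the ideal contains all r^*(X_i).
  have h1 : (Ideal.Quotient.mkₐ (ResidueField O) I).comp (comparisonCoord p ϖ).hom =
      (Algebra.ofId (ResidueField O) _).comp (MvPolynomial.aeval fun _ => (0 : ResidueField O)) :=
    MvPolynomial.algHom_ext fun i => by
      rw [AlgHom.comp_apply, AlgHom.comp_apply, MvPolynomial.aeval_X, map_zero]
      exact Ideal.Quotient.eq_zero_iff_mem.mpr (Ideal.subset_span ⟨i, rfl⟩)
  let c : ResidueField O := MvPolynomial.aeval (fun _ => (0 : ResidueField O)) s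
  have h2 : (MvPolynomial.X j : greenbergRing p O) ^ p ^ n - MvPolynomial.C c ∈ I := by
    rw [← Ideal.Quotient.eq, ← hs]
    exact DFunLike.congr_fun h1 s
  have h3 := (isSubgroupIdeal_kernelIdeal p ϖ).zero_mem (ResidueField O) _ h2
  have h4 : WittLocus.eval p (ResidueField O)
      (0 : Fin (absRamification p O) → WittVector p (ResidueField O)) (MvPolynomial.X j) = 0 :=
    (MvPolynomial.aeval_X _ _).trans (WittVector.zero_coeff _ _ _)
  have h5 : WittLocus.eval p (ResidueField O)
      (0 : Fin (absRamification p O) → WittVector p (ResidueField O)) (MvPolynomial.C c) = c :=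
    MvPolynomial.aeval_C _ _
  rw [map_sub, map_pow, h4, h5, zero_pow (pow_ne_zero n (Fact.out : p.Prime).ne_zero), zero_sub,
    neg_eq_zero] at h3
  rwa [h3, map_zero, sub_zero] at h2

/-- The kernel of the comparison morphism is the group defined by the ideal `kernelIdeal`. -/
noncomputable def kernelIso :
    WittLocus.group p (isSubgroupIdeal_kernelIdeal p ϖ) ≅ comparisonKernel p ϖ :=
  NatIso.ofComponents (fun A => AddEquiv.toAddCommGrpIso
    (X := AddCommGrpCat.of (WittLocus.subgroup p (isSubgroupIdeal_kernelIdeal p ϖ) A))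
    (Y := AddCommGrpCat.of (RingHom.ker ((comparison p ϖ).app A).hom))
    { toFun := fun x => ⟨greenbergCoordAddEquiv p O A x.1,
        (greenbergCoord_mem_ker_iff p ϖ A x.1).mpr x.2⟩
      invFun := fun y => ⟨(greenbergCoordAddEquiv p O A).symm y.1,
        (greenbergCoord_mem_ker_iff p ϖ A _).mp
          ((congrArg (fun z => z ∈ RingHom.ker ((comparison p ϖ).app A).hom)
            ((greenbergCoordAddEquiv p O A).apply_symm_apply y.1)).mpr y.2)⟩
      left_inv := fun x => Subtype.ext ((greenbergCoordAddEquiv p O A).symm_apply_apply x.1)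
      right_inv := fun y => Subtype.ext ((greenbergCoordAddEquiv p O A).apply_symm_apply y.1)
      map_add' := fun x y => Subtype.ext (map_add (greenbergCoordAddEquiv p O A) x.1 y.1) })
    fun {A B} f => by
      ext x
      refine Subtype.ext ?_
      change greenbergCoord p O B (fun i => WittVector.map (f.hom : A →+* B) (x.1 i)) =
        Algebra.TensorProduct.map (AlgHom.id O O) (wittMapAlgHom p f.hom)
          (greenbergCoord p O A x.1)
      rw [greenbergCoord_apply, greenbergCoord_apply, map_sum]
      rfl

theorem isProInfinitesimal_comparisonKernel : IsProInfinitesimal (comparisonKernel p ϖ) := by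
  obtain ⟨J, hJ, hJ', F, c, hc, ⟨e⟩, hF⟩ := WittLocus.isProInfinitesimal_group p
    (isSubgroupIdeal_kernelIdeal p ϖ) (exists_X_pow_mem_kernelIdeal p ϖ)
  exact ⟨J, hJ, hJ', F, c, hc, ⟨e ≪≫ kernelIso p ϖ⟩, hF⟩

end Kernel

theorem theorem5p2 (p : ℕ) [Fact p.Prime] (O : Type u) [CommRing O] [IsDomain O]
    [IsDiscreteValuationRing O] [IsAdicComplete (maximalIdeal O) O] [CharZero O]
    [Finite (ResidueField O)] [CharP (ResidueField O) p] (ϖ : Uniformizer O) :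
    IsIso (perfectionMap p (comparisonRingHom p ϖ)) ∧
      IsUniversalHomeomorphism (comparisonMorphism p ϖ) ∧
      AlgebraicGeometry.Surjective (comparisonMorphism p ϖ) ∧
      IsProInfinitesimal (comparisonKernel p ϖ) := by
  obtain ⟨hinj, hpow⟩ := comparisonCoord_injective_and_exists_pow p ϖ
  have hu : IsUniversalHomeomorphism (comparisonMorphism p ϖ) :=
    isUniversalHomeomorphism_specMap p (comparisonRingHom p ϖ) hinj hpow
  refine ⟨isIso_perfectionMap p (comparisonRingHom p ϖ) hinj hpow, hu, ?_,
    isProInfinitesimal_comparisonKernel p ϖ⟩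
  -- The base change along the identity.
  have h : IsHomeomorph (comparisonMorphism p ϖ) := hu _ _ _ IsPullback.of_id_snd
  exact ⟨h.surjective⟩
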